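/- Let $\alpha>0$, $0<a<b$, and put \[ S_0=\bigcup_{k=0}^{2}e^{2\pi i k/3}[0,\alpha],\qquad S_1=\bigcup_{k=0}^{2}e^{2\pi i k/3}[-b,-a]. \] Let $s_1$ be a complex-valued function on $S_0$ such that $s_1\ge 0$ on $(0,\alpha)$, $s_1\in L^1(0,\alpha)$, $s_1$ is not almost everywhere zero on $(0,\alpha)$, and $s_1(e^{2\pi i/3}z)=e^{4\pi i/3}s_1(z)$ for all $z\in S_0\setminus\{0,\alpha,e^{2\pi i/3}\alpha,e^{4\pi i/3}\alpha\}$. Let $s_2$ be a non-negative integrable function on $[-b,-a]$ that is not almost everywhere zero, and set \[ f(z)=z^2\int_{-b}^{-a}\frac{s_2(t)}{z^3-t^3}\,dt . \] Integrals over $S_0$ are complex line integrals in which each of the three segments is oriented outwards from $0$. For $n\ge 0$ let $Q_n$ be the monic polynomial of lowest degree such that \[ \int_{S_0}Q_n(t)\,t^k s_1(t)\,dt=0\quad(0\le k<\lceil n/2\rceil),\qquad \int_{S_0}Q_n(t)\,t^k f(t)\,s_1(t)\,dt=0\quad(0\le k<\lfloor n/2\rfloor), \] and let \[ \Psi_n(z)=\int_{S_0}\frac{Q_n(t)}{t-z}\,s_1(t)\,dt,\qquad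 z\in\mathbb{C}\setminus S_0 . \] Theorem 1.1. For every $n\ge 0$, the polynomials $Q_n$ and $Q_{n+1}$ have no common zeros in $S_0\setminus\{0\}$. Moreover, there is exactly one zero of $Q_{n+1}$ strictly between any two consecutive zeros of $Q_n$ in $(0,\alpha)$ and, conversely, exactly one zero of $Q_n$ strictly between any two consecutive zeros of $Q_{n+1}$ in $(0,\alpha)$. Additionally, for every $n\ge 0$, the functions $\Psi_n$ and $\Psi_{n+1}$ have no common zeros in $S_1$. There is exactly one zero of $\Psi_{n+1}$ strictly between any two consecutive zeros of $\Psi_n$ in $(-b,-a)$, and exactly one zero of $\Psi_n$ strictly between any two consecutive zeros of $\Psi_{n+1}$ in $(-b,-a)$. -/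

import Mathlib

open MeasureTheory Set Polynomial

/-- The `k`-th cube root of unity `exp (2πik/3)`. -/
noncomputable def cubeRoot (k : ℕ) : ℂ :=
  Complex.exp (2 * (Real.pi : ℂ) * Complex.I * (k : ℂ) / 3)

/-- The three-ray star over a set `I ⊆ ℝ`: the union of `exp (2πik/3) • I` for `k = 0, 1, 2`.
Thus `star3 (Icc 0 α)` is `S₀` and `star3 (Icc (-b) (-a))` is `S₁`. -/
def star3 (I : Set ℝ) : Set ℂ :=
  {z | ∃ k < 3, ∃ t ∈ I, z = cubeRoot k * (t : ℂ)}

/-- The complex line integral `∫_{S₀} g(t) dt`, where each of the three segments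
`exp (2πik/3) [0, α]` is oriented from `0` outwards. -/
noncomputable def starIntegral (α : ℝ) (g : ℂ → ℂ) : ℂ :=
  ∑ k ∈ Finset.range 3, cubeRoot k * ∫ t in (0 : ℝ)..α, g (cubeRoot k * (t : ℂ))

/-- `f(z) = z² ∫_{-b}^{-a} s₂(t) / (z³ - t³) dt`. -/
noncomputable def nikishinF (a b : ℝ) (s₂ : ℝ → ℝ) (z : ℂ) : ℂ :=
  z ^ 2 * ∫ t in (-b)..(-a), (s₂ t : ℂ) / (z ^ 3 - (t : ℂ) ^ 3)

/-- The orthogonality conditions for the index `n`: orthogonality to `t ^ k` with respect to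
`s₁(t) dt` for `0 ≤ k < ⌈n/2⌉`, and with respect to `f(t) s₁(t) dt` for `0 ≤ k < ⌊n/2⌋`.
For `n = 2m` both ranges are `0, …, m - 1`; for `n = 2m + 1` the first one is `0, …, m`
and the second one is `0, …, m - 1`. -/
def MultiOrthogonal (α a b : ℝ) (s₁ : ℂ → ℂ) (s₂ : ℝ → ℝ) (n : ℕ) (P : ℂ[X]) : Prop :=
  (∀ k < (n + 1) / 2, starIntegral α (fun t => P.eval t * t ^ k * s₁ t) = 0) ∧
  (∀ k < n / 2, starIntegral α (fun t => P.eval t * t ^ k * nikishinF a b s₂ t * s₁ t) = 0)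

/-- `P` is the monic polynomial `Q_n` of lowest degree that satisfies the `n`-th orthogonality
conditions. -/
structure IsMultiOrthPoly (α a b : ℝ) (s₁ : ℂ → ℂ) (s₂ : ℝ → ℝ) (n : ℕ) (P : ℂ[X]) : Prop where
  monic : P.Monic
  orthogonal : MultiOrthogonal α a b s₁ s₂ n P
  lowest_degree : ∀ R : ℂ[X], R.Monic → MultiOrthogonal α a b s₁ s₂ n R →
    P.natDegree ≤ R.natDegree

/-- The function of second type `Ψ(z) = ∫_{S₀} P(t) s₁(t) / (t - z) dt` associated with `P`
(meaningful for `z` outside `S₀`). -/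
noncomputable def secondType (α : ℝ) (s₁ : ℂ → ℂ) (P : ℂ[X]) (z : ℂ) : ℂ :=
  starIntegral α (fun t => P.eval t / (t - z) * s₁ t)

/-- `x < y` are two consecutive zeros of `F` in the real set `I` (an interval). -/
def ConsecutiveZeros (F : ℂ → ℂ) (I : Set ℝ) (x y : ℝ) : Prop :=
  x ∈ I ∧ y ∈ I ∧ x < y ∧ F x = 0 ∧ F y = 0 ∧ ∀ t ∈ Ioo x y, F t ≠ 0

/-- Between any two consecutive zeros of `F` in `I` there is exactly one zero of `G`. -/
def OneZeroBetween (F G : ℂ → ℂ) (I : Set ℝ) : Prop :=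
  ∀ x y : ℝ, ConsecutiveZeros F I x y → ∃! t : ℝ, t ∈ Ioo x y ∧ G t = 0

/-- `h` is integrable along each of the three segments of `S₀`. -/
def StarIntegrable (α : ℝ) (h : ℂ → ℂ) : Prop :=
  ∀ k < 3, IntervalIntegrable (fun t : ℝ => h (cubeRoot k * (t : ℂ))) volume 0 α

theorem exists_isMultiOrthPoly_aux (α : ℝ) (g h : ℂ → ℂ)
    (hg : StarIntegrable α g) (hh : StarIntegrable α h) (p q : ℕ) :
    ∃ P : ℂ[X], P.Monic ∧
      (∀ k < p, starIntegral α (fun t => P.eval t * t ^ k * g t) = 0) ∧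
      (∀ k < q, starIntegral α (fun t => P.eval t * t ^ k * h t) = 0) := by
  have key : ∀ (u : ℂ → ℂ), StarIntegrable α u → ∀ k : ℕ, ∃ L : ℂ[X] →ₗ[ℂ] ℂ,
      ∀ P, L P = starIntegral α (fun t => P.eval t * t ^ k * u t) := by
    intro u hu k
    have hi : ∀ (P : ℂ[X]) (j : ℕ), j < 3 → IntervalIntegrable
        (fun t : ℝ => P.eval (cubeRoot j * (t : ℂ)) * (cubeRoot j * (t : ℂ)) ^ k *
          u (cubeRoot j * (t : ℂ))) volume 0 α := by
      intro P j hj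
      refine (hu j hj).continuousOn_mul (Continuous.continuousOn ?_)
      have : Continuous (fun t : ℝ => cubeRoot j * (t : ℂ)) := by fun_prop
      exact (P.continuous.comp this).mul (this.pow k)
    refine ⟨{ toFun := fun P => starIntegral α (fun t => P.eval t * t ^ k * u t)
              map_add' := ?_, map_smul' := ?_ }, fun P => rfl⟩
    · intro P R
      simp only [starIntegral]
      rw [← Finset.sum_add_distrib]
      refine Finset.sum_congr rfl fun j hj => ?_
      have hj := Finset.mem_range.1 hj
      rw [← mul_add, ← intervalIntegral.integral_add (hi P j hj) (hi R j hj)]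
      simp only [eval_add, add_mul]
    · intro c P
      simp only [starIntegral, RingHom.id_apply, smul_eq_mul]
      rw [Finset.mul_sum]
      refine Finset.sum_congr rfl fun j hj => ?_
      rw [mul_left_comm, ← intervalIntegral.integral_const_mul c]
      simp only [eval_smul, smul_eq_mul, mul_assoc]
  choose L₁ hL₁ using key g hg
  choose L₂ hL₂ using key h hh
  let Φ : ℂ[X] →ₗ[ℂ] ((Fin p → ℂ) × (Fin q → ℂ)) :=
    (LinearMap.pi fun i : Fin p => L₁ i).prod (LinearMap.pi fun i : Fin q => L₂ i)
  let Φ' := (Φ.comp (degreeLT ℂ (p + q + 1)).subtype).comp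
    (degreeLTEquiv ℂ (p + q + 1)).symm.toLinearMap
  obtain ⟨v, hv, hv0⟩ : ∃ v, Φ' v = 0 ∧ v ≠ 0 := by
    have : ¬ Function.Injective Φ' := by
      intro hinj
      have := LinearMap.finrank_le_finrank_of_injective hinj
      simp at this
    rw [← LinearMap.ker_eq_bot] at this
    obtain ⟨v, hv, h0⟩ := Submodule.exists_mem_ne_zero_of_ne_bot this
    exact ⟨v, hv, h0⟩
  set R : ℂ[X] := ((degreeLTEquiv ℂ (p + q + 1)).symm v : ℂ[X]) with hR
  have hR0 : R ≠ 0 := by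
    simpa [hR] using hv0
  have hΦ : Φ R = 0 := hv
  have hc : R.leadingCoeff⁻¹ ≠ 0 := inv_ne_zero (leadingCoeff_ne_zero.2 hR0)
  have hΦ2 : Φ (R.leadingCoeff⁻¹ • R) = 0 := by rw [map_smul, hΦ, smul_zero]
  refine ⟨R.leadingCoeff⁻¹ • R, ?_, ?_, ?_⟩
  · rw [smul_eq_C_mul, mul_comm]
    exact monic_mul_leadingCoeff_inv hR0
  · intro k hk
    rw [← hL₁]
    exact congrFun (congrArg Prod.fst hΦ2) ⟨k, hk⟩
  · intro k hk
    rw [← hL₂]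
    exact congrFun (congrArg Prod.snd hΦ2) ⟨k, hk⟩

theorem cubeRoot_pow_three (k : ℕ) : cubeRoot k ^ 3 = 1 := by
  rw [cubeRoot, ← Complex.exp_nat_mul, Complex.exp_eq_one_iff]
  exact ⟨k, by push_cast; ring⟩

theorem cubeRoot_add (j k : ℕ) : cubeRoot (j + k) = cubeRoot j * cubeRoot k := by
  rw [cubeRoot, cubeRoot, cubeRoot, ← Complex.exp_add]
  congr 1; push_cast; ring

/-- Well-definedness: the monic polynomial of lowest degree exists for every index. -/
theorem exists_isMultiOrthPoly (α a b : ℝ) (hα : 0 < α) (ha : 0 < a) (hab : a < b)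
    (s₁ : ℂ → ℂ)
    (hs₁_int : IntegrableOn (fun t : ℝ => s₁ t) (Ioo 0 α))
    (hs₁_symm : ∀ z ∈ star3 (Ioo 0 α), s₁ (cubeRoot 1 * z) = cubeRoot 2 * s₁ z)
    (s₂ : ℝ → ℝ) (hs₂_int : IntegrableOn s₂ (Icc (-b) (-a))) (n : ℕ) :
    ∃ P, IsMultiOrthPoly α a b s₁ s₂ n P := by
  have hsk : ∀ k < 3, ∀ t ∈ Ioo (0 : ℝ) α,
      s₁ (cubeRoot k * (t : ℂ)) = cubeRoot (2 * k) * s₁ t := by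
    intro k hk t ht
    induction k with
    | zero => simp [cubeRoot]
    | succ k ih =>
      rw [add_comm k 1, cubeRoot_add, mul_assoc, hs₁_symm _ ⟨k, by omega, t, ht, rfl⟩,
        ih (by omega), ← mul_assoc, ← cubeRoot_add]
      congr 2
      ring
  have h1 : StarIntegrable α s₁ := by
    intro k hk
    rw [intervalIntegrable_iff_integrableOn_Ioo_of_le hα.le]
    exact IntegrableOn.congr_fun (hs₁_int.const_mul (cubeRoot (2 * k)))
      (fun t ht => (hsk k hk t ht).symm) measurableSet_Ioo
  have hden : ∀ x ∈ Icc (0 : ℝ) α, ∀ t ∈ Icc (-b) (-a), a ^ 3 ≤ x ^ 3 - t ^ 3 := by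
    intro x hx t ht
    have h3 : a ^ 3 ≤ (-t) ^ 3 := pow_le_pow_left₀ ha.le (by linarith [ht.2]) 3
    have h4 : 0 ≤ x ^ 3 := pow_nonneg hx.1 3
    nlinarith
  have hf : ∀ k : ℕ, ContinuousOn
      (fun x : ℝ => nikishinF a b s₂ (cubeRoot k * (x : ℂ))) (Icc 0 α) := by
    intro k
    have e : ∀ x : ℝ, (cubeRoot k * (x : ℂ)) ^ 3 = (x : ℂ) ^ 3 := fun x => by
      rw [mul_pow, cubeRoot_pow_three, one_mul]
    simp only [nikishinF, e]
    refine ContinuousOn.mul (by fun_prop) ?_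
    simp only [intervalIntegral.integral_of_le (show -b ≤ -a by linarith),
      ← integral_Icc_eq_integral_Ioc]
    refine continuousOn_of_dominated (bound := fun t => ‖s₂ t‖ * (a ^ 3)⁻¹) ?_ ?_ ?_ ?_
    · intro x hx
      refine AEStronglyMeasurable.mul (f := fun t : ℝ => (s₂ t : ℂ))
        (Complex.continuous_ofReal.comp_aestronglyMeasurable hs₂_int.1) ?_
      exact Measurable.aestronglyMeasurable (by fun_prop)
    · intro x hx
      refine (ae_restrict_iff' measurableSet_Icc).2 (.of_forall fun t ht => ?_)
      have := hden x hx t ht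
      have h5 : ‖(x : ℂ) ^ 3 - (t : ℂ) ^ 3‖ = |x ^ 3 - t ^ 3| := by
        rw [← Complex.ofReal_pow, ← Complex.ofReal_pow, ← Complex.ofReal_sub, Complex.norm_real,
            Real.norm_eq_abs]
      rw [norm_div, Complex.norm_real, h5, div_eq_mul_inv]
      gcongr
      exact this.trans (le_abs_self _)
    · exact hs₂_int.norm.mul_const _
    · refine (ae_restrict_iff' measurableSet_Icc).2 (.of_forall fun t ht => ?_)
      refine ContinuousOn.div (by fun_prop) (by fun_prop) fun x hx => ?_
      have := hden x hx t ht
      have h6 : x ^ 3 - t ^ 3 ≠ 0 := by have := pow_pos ha 3; linarith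
      exact_mod_cast h6
  have h2 : StarIntegrable α (fun t => nikishinF a b s₂ t * s₁ t) := by
    intro k hk
    refine (h1 k hk).continuousOn_mul ?_
    rw [uIcc_of_le hα.le]
    exact hf k
  obtain ⟨P, hP, hP1, hP2⟩ :=
    exists_isMultiOrthPoly_aux α _ _ h1 h2 ((n + 1) / 2) (n / 2)
  have hne : ∃ d, ∃ P : ℂ[X], P.natDegree = d ∧ P.Monic ∧ MultiOrthogonal α a b s₁ s₂ n P :=
    ⟨_, P, rfl, hP, hP1, by simpa only [mul_assoc] using hP2⟩
  classical
  obtain ⟨R, hRd, hRm, hRo⟩ := Nat.find_spec hne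
  exact ⟨R, hRm, hRo, fun S hS hSo => hRd ▸ Nat.find_min' hne ⟨S, rfl, hS, hSo⟩⟩

/-! Everything is moved to the real line by x = t³. The symmetry of s₁ makes the three rays
contribute equally, so the average over the rays keeps only the powers of t divisible by 3. The data
become two measures without atoms: μ on (0, α³) and σ on (-b³, -a³). The conditions decouple
according to the residue of the exponent mod 3, whence Q_n(z) = z^(n % 3) q_n(z³) with q_n real of
degree n / 3. For z³ = y < 0, Ψ_n(z) is a nonzero multiple of the Cauchy transform at y of q_n(x)
x^e dμ(x), e being 0 or 1.

Suppose that p w is orthogonal to degrees below M for μ, and that N further conditions involve the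
Stieltjes transform of σ. By Fubini, those N conditions say that the Cauchy transform of p w is
orthogonal to N powers for σ, so it changes sign at least N times on the support interval of σ.
Dividing the weight by the factors x - s of these zeros gains one orthogonality relation each; hence
p changes sign at least M + N times on (0, α³). This gives a lower bound for the degree, hence
existence, uniqueness and full degree of Q_n. If deg p ≤ M + N + 1, there is no room for a double
zero of p, nor for one of the transform (`eval_derivative_ne_zero_of_orthogonal`,
`deriv_cauchyTransform_ne_zero_of_orthogonal`).

For interlacing, consider B z Q_n + C Q_{n+1} with B, C real and not both zero. Multiplication by z
costs two indices, so the combination satisfies the conditions of index n - 2 and has degree at most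
n + 1: exactly one spare degree in x. Thus every such combination has only simple zeros
(`simple_zeros_of_consecutive`), the Wronskian of the pair never vanishes, and Rolle's theorem
yields both the absence of common zeros and the interlacing. The same combinations serve for Q and
for Ψ. -/

/-! ### Interlacing from a nonvanishing Wronskian. -/

/-- If `G` had no zero there, Rolle's theorem for F / G, whose derivative has the Wronskian as
numerator up to sign, would give a contradiction. At the endpoints `G` is nonzero because `F`
vanishes there. -/
theorem exists_zero_of_wronskian_ne_zero {I : Set ℝ} (hI : I.OrdConnected) {F G F' G' : ℝ → ℝ}
    (hF : ∀ t ∈ I, HasDerivAt F (F' t) t) (hG : ∀ t ∈ I, HasDerivAt G (G' t) t)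
    (hW : ∀ t ∈ I, F t * G' t ≠ F' t * G t) {x y : ℝ} (hx : x ∈ I) (hy : y ∈ I) (hxy : x < y)
    (hFx : F x = 0) (hFy : F y = 0) : ∃ t ∈ Ioo x y, G t = 0 := by
  by_contra! h
  have hsub : Icc x y ⊆ I := hI.out hx hy
  have hG0 : ∀ t ∈ Icc x y, G t ≠ 0 := by
    intro t ht h0
    have hcom := hW t (hsub ht)
    rcases ht.1.eq_or_lt with rfl | h1
    · simp [hFx, h0] at hcom
    rcases ht.2.eq_or_lt with rfl | h2
    · simp [hFy, h0] at hcom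
    exact h t ⟨h1, h2⟩ h0
  have hd : ∀ t ∈ Icc x y,
      HasDerivAt (fun u => F u / G u) ((F' t * G t - F t * G' t) / G t ^ 2) t := fun t ht =>
    (hF t (hsub ht)).div (hG t (hsub ht)) (hG0 t ht)
  obtain ⟨t, ht, h0⟩ := exists_hasDerivAt_eq_zero hxy
    (fun t ht => (hd t ht).continuousAt.continuousWithinAt) (by simp [hFx, hFy])
    (fun t ht => hd t (Ioo_subset_Icc_self ht))
  have ht' := Ioo_subset_Icc_self ht
  rw [div_eq_zero_iff] at h0
  rcases h0 with h0 | h0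
  · exact hW t (hsub ht') (by linarith)
  · exact hG0 t ht' (by simpa using h0)

theorem existsUnique_zero_of_wronskian_ne_zero {I : Set ℝ} (hI : I.OrdConnected)
    {F G F' G' : ℝ → ℝ}
    (hF : ∀ t ∈ I, HasDerivAt F (F' t) t) (hG : ∀ t ∈ I, HasDerivAt G (G' t) t)
    (hW : ∀ t ∈ I, F t * G' t ≠ F' t * G t) {x y : ℝ} (hx : x ∈ I) (hy : y ∈ I) (hxy : x < y)
    (hFx : F x = 0) (hFy : F y = 0) (hne : ∀ t ∈ Ioo x y, F t ≠ 0) :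
    ∃! t : ℝ, t ∈ Ioo x y ∧ G t = 0 := by
  obtain ⟨t, ht, h0⟩ := exists_zero_of_wronskian_ne_zero hI hF hG hW hx hy hxy hFx hFy
  have hsub : Icc x y ⊆ I := hI.out hx hy
  have key : ∀ u v, u ∈ Ioo x y → v ∈ Ioo x y → G u = 0 → G v = 0 → ¬ u < v := by
    intro u v hu hv hu0 hv0 huv
    obtain ⟨w, hw, hw0⟩ := exists_zero_of_wronskian_ne_zero hI hG hF
      (fun t ht h => hW t ht (by linarith))
      (hsub (Ioo_subset_Icc_self hu)) (hsub (Ioo_subset_Icc_self hv)) huv hu0 hv0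
    exact hne w ⟨hu.1.trans hw.1, hw.2.trans hv.2⟩ hw0
  refine ⟨t, ⟨ht, h0⟩, fun u hu => ?_⟩
  rcases lt_trichotomy u t with h | h | h
  · exact (key u t hu.1 ht hu.2 h0 h).elim
  · exact h
  · exact (key t u ht hu.1 h0 hu.2 h).elim

/-- If no nontrivial real combination of `F` and `G` has a double zero, then the Wronskian does not
vanish. -/
theorem wronskian_ne_zero_of_simple {f g f' g' : ℝ}
    (h : ∀ A B : ℝ, (A ≠ 0 ∨ B ≠ 0) → A * f + B * g = 0 → A * f' + B * g' ≠ 0) :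
    f * g' ≠ f' * g := by
  intro hW
  by_cases hf : f = 0
  · by_cases hg : g = 0
    · by_cases hf' : f' = 0
      · exact h 1 0 (by simp) (by simp [hf]) (by simp [hf'])
      · exact h g' (-f') (by simp [hf']) (by simp [hf, hg]) (by ring)
    · exact h g (-f) (by simp [hg]) (by ring) (by linarith)
  · exact h g (-f) (by simp [hf]) (by ring) (by linarith)

/-! ### Sign changes and orthogonality. -/

theorem exists_sign_of_ne_zero {c d : ℝ} {F : ℝ → ℝ} (hF : ContinuousOn F (Ioo c d))
    (h0 : ∀ x ∈ Ioo c d, F x ≠ 0) : ∃ ε : ℝ, ε ≠ 0 ∧ ∀ x ∈ Ioo c d, 0 ≤ ε * F x := by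
  by_cases h : ∀ x ∈ Ioo c d, 0 ≤ F x
  · exact ⟨1, one_ne_zero, fun x hx => by simpa using h x hx⟩
  · push Not at h
    obtain ⟨x, hx, hxn⟩ := h
    refine ⟨-1, by norm_num, fun y hy => ?_⟩
    by_contra! hlt
    obtain ⟨z, hz, hz0⟩ := isPreconnected_Ioo.intermediate_value hx hy hF
      (show (0 : ℝ) ∈ Icc (F x) (F y) from ⟨hxn.le, by linarith⟩)
    exact h0 z hz hz0

/-- A continuous function with finitely many zeros has, up to a constant, the same sign as the
monic polynomial that vanishes simply at some of these zeros. -/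
theorem exists_finset_sign {c d : ℝ} {F : ℝ → ℝ} (hF : ContinuousOn F (Ioo c d))
    (hfin : {x ∈ Ioo c d | F x = 0}.Finite) :
    ∃ S : Finset ℝ, (∀ s ∈ S, s ∈ Ioo c d ∧ F s = 0) ∧
      ∃ ε : ℝ, ε ≠ 0 ∧ ∀ z ∈ Ioo c d, 0 ≤ ε * F z * ∏ s ∈ S, (z - s) := by
  induction hk : {x ∈ Ioo c d | F x = 0}.ncard using Nat.strong_induction_on generalizing d with
  | _ k ih =>
  by_cases hZ : {x ∈ Ioo c d | F x = 0}.Nonempty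
  · obtain ⟨m, hm⟩ := hfin.exists_maximal hZ
    have hm0 : F m = 0 := hm.1.2
    have hmI : m ∈ Ioo c d := hm.1.1
    have hmax : ∀ x ∈ Ioo m d, F x ≠ 0 := fun x hx h0 =>
      (hm.2 (⟨⟨hmI.1.trans hx.1, hx.2⟩, h0⟩ : x ∈ {x ∈ Ioo c d | F x = 0}) hx.1.le).not_gt hx.1
    have hsub : {x ∈ Ioo c m | F x = 0} ⊆ {x ∈ Ioo c d | F x = 0} := fun x hx =>
      ⟨⟨hx.1.1, hx.1.2.trans hmI.2⟩, hx.2⟩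
    have hlt : {x ∈ Ioo c m | F x = 0}.ncard < k := by
      rw [← hk]
      exact ncard_lt_ncard ⟨hsub, fun h => (h hm.1).1.2.false⟩ hfin
    obtain ⟨S, hS, ε, hε, hs⟩ := ih _ hlt
      (hF.mono fun x hx => ⟨hx.1, hx.2.trans hmI.2⟩) (hfin.subset hsub) rfl
    obtain ⟨η, hη, ht⟩ := exists_sign_of_ne_zero
      (hF.mono (Ioo_subset_Ioo_left hmI.1.le : Ioo m d ⊆ Ioo c d)) hmax
    have hpos : ∀ z ∈ Ioo m d, 0 ≤ ∏ s ∈ S, (z - s) := fun z hz =>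
      Finset.prod_nonneg fun s hs => by linarith [(hS s hs).1.2, hz.1]
    have hmS : m ∉ S := fun h => (hS m h).1.2.false
    have hcases : ∀ z ∈ Ioo c d, z ∈ Ioo c m ∨ z = m ∨ z ∈ Ioo m d := fun z hz => by
      rcases lt_trichotomy z m with h | h | h
      · exact .inl ⟨hz.1, h⟩
      · exact .inr (.inl h)
      · exact .inr (.inr ⟨h, hz.2⟩)
    have hS' : ∀ s ∈ S, s ∈ Ioo c d ∧ F s = 0 := fun s h =>
      ⟨⟨(hS s h).1.1, (hS s h).1.2.trans hmI.2⟩, (hS s h).2⟩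
    -- The largest zero `m` joins `S` exactly when the sign to its right disagrees with the sign
    -- predicted by the zeros to its left.
    by_cases hsg : 0 < ε * η
    · refine ⟨S, hS', ε, hε, fun z hz => ?_⟩
      rcases hcases z hz with h | rfl | h
      · exact hs z h
      · simp [hm0]
      · have h1 : 0 ≤ (ε * η) * (η * F z) := mul_nonneg hsg.le (ht z h)
        have h2 : 0 ≤ ε * F z := by
          have h3 : (ε * η) * (η * F z) = η ^ 2 * (ε * F z) := by ring
          rw [h3] at h1
          exact nonneg_of_mul_nonneg_right h1 (by positivity)
        exact mul_nonneg h2 (hpos z h)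
    · refine ⟨insert m S, ?_, -ε, by simpa using hε, fun z hz => ?_⟩
      · intro s h
        rcases Finset.mem_insert.1 h with rfl | h
        · exact ⟨hmI, hm0⟩
        · exact hS' s h
      rw [Finset.prod_insert hmS]
      rcases hcases z hz with h | rfl | h
      · have := mul_nonneg (hs z h) (sub_nonneg.2 h.2.le)
        calc _ ≤ _ := this
          _ = _ := by ring
      · simp
      · have hne : ε * η < 0 := lt_of_le_of_ne (not_lt.1 hsg) (mul_ne_zero hε hη)
        have h1 : 0 ≤ (-(ε * η)) * (η * F z) := mul_nonneg (by linarith) (ht z h)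
        have h2 : 0 ≤ -ε * F z := by
          have h3 : (-(ε * η)) * (η * F z) = η ^ 2 * (-ε * F z) := by ring
          rw [h3] at h1
          exact nonneg_of_mul_nonneg_right h1 (by positivity)
        exact mul_nonneg h2 (mul_nonneg (by linarith [h.1]) (hpos z h))
  · rw [not_nonempty_iff_eq_empty] at hZ
    obtain ⟨ε, hε, h⟩ := exists_sign_of_ne_zero hF fun x hx h0 => by
      exact hZ.subset (⟨hx, h0⟩ : x ∈ {x ∈ Ioo c d | F x = 0})
    exact ⟨∅, by simp, ε, hε, by simpa using h⟩

/-- If the product over `S` already accounts for all signs, an additional factor z - y must be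
compensated by `H`: near y, ε H is nonnegative on the right and nonpositive on the left. The point y
may belong to `S`. -/
theorem eq_zero_of_sign_change {c d y : ℝ} (hy : y ∈ Ioo c d) (S : Finset ℝ) {ε : ℝ} (hε : ε ≠ 0)
    {H : ℝ → ℝ} (hH : ContinuousAt H y)
    (h : ∀ z ∈ Ioo c d, 0 ≤ ε * ((∏ s ∈ S, (z - s)) * ((z - y) * H z)) * ∏ s ∈ S, (z - s)) :
    H y = 0 := by
  have hS : ∀ᶠ z in nhds y, z ∉ (S : Set ℝ) \ {y} :=
    (S.finite_toSet.subset sdiff_subset).isClosed.isOpen_compl.mem_nhds (by simp)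
  have key : ∀ᶠ z in nhds y, z ≠ y → 0 ≤ ε * ((z - y) * H z) := by
    filter_upwards [hS, Ioo_mem_nhds hy.1 hy.2] with z hz hzI hzy
    have hP : ∏ s ∈ S, (z - s) ≠ 0 := Finset.prod_ne_zero_iff.2 fun s hs h0 =>
      hz ⟨by rwa [sub_eq_zero.1 h0], by simpa using hzy⟩
    have h1 := h z hzI
    rw [show ε * ((∏ s ∈ S, (z - s)) * ((z - y) * H z)) * ∏ s ∈ S, (z - s)
      = (∏ s ∈ S, (z - s)) ^ 2 * (ε * ((z - y) * H z)) by ring] at h1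
    exact nonneg_of_mul_nonneg_right h1 (by positivity)
  have hc : ContinuousAt (fun z => ε * H z) y := continuousAt_const.mul hH
  have h1 : 0 ≤ ε * H y := by
    refine ge_of_tendsto (hc.tendsto.mono_left (nhdsWithin_le_nhds (s := Ioi y))) ?_
    filter_upwards [key.filter_mono nhdsWithin_le_nhds, self_mem_nhdsWithin] with z hz hzy
    have hzy : y < z := hzy
    have := hz hzy.ne'
    rw [show ε * ((z - y) * H z) = (z - y) * (ε * H z) by ring] at this
    exact nonneg_of_mul_nonneg_right this (by linarith)
  have h2 : ε * H y ≤ 0 := by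
    refine le_of_tendsto (hc.tendsto.mono_left (nhdsWithin_le_nhds (s := Iio y))) ?_
    filter_upwards [key.filter_mono nhdsWithin_le_nhds, self_mem_nhdsWithin] with z hz hzy
    have hzy : z < y := hzy
    have := hz hzy.ne
    rw [show ε * ((z - y) * H z) = (y - z) * (-(ε * H z)) by ring] at this
    have := nonneg_of_mul_nonneg_right this (by linarith)
    linarith
  exact (mul_eq_zero.1 (le_antisymm h2 h1)).resolve_left hε

theorem integral_pos_of_finite_zeros {m : Measure ℝ} [NullSingletonClass m] (hm : m ≠ 0) {J : Set ℝ}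
    (hJ : ∀ᵐ x ∂m, x ∈ J) {h : ℝ → ℝ} (h0 : ∀ x ∈ J, 0 ≤ h x) (hfin : {x ∈ J | h x = 0}.Finite)
    (hint : Integrable h m) : 0 < ∫ x, h x ∂m := by
  have hnn : 0 ≤ᵐ[m] h := hJ.mono h0
  refine lt_of_le_of_ne (integral_nonneg_of_ae hnn) fun h' => ?_
  have h2 := (integral_eq_zero_iff_of_nonneg_ae hnn hint).1 h'.symm
  have h3 : ∀ᵐ x ∂m, x ∈ {x ∈ J | h x = 0} := by
    filter_upwards [hJ, h2] with x hx hx0 using ⟨hx, hx0⟩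
  have h4 : ∀ᵐ x ∂m, x ∉ {x ∈ J | h x = 0} := measure_eq_zero_iff_ae_notMem.1 (hfin.measure_zero m)
  have h5 : ∀ᵐ x ∂m, False := by
    filter_upwards [h3, h4] with x h h' using h' h
  exact hm (ae_eq_bot.1 (Filter.eventually_false_iff_eq_bot.1 h5))

/-- A function orthogonal to all polynomials of degree less than `K` changes sign at least `K`
times. -/
theorem exists_sign_changes {m : Measure ℝ} [NullSingletonClass m] (hm : m ≠ 0) {c d : ℝ}
    (hJ : ∀ᵐ x ∂m, x ∈ Ioo c d) {F w : ℝ → ℝ} (hF : ContinuousOn F (Ioo c d))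
    (hfin : {x ∈ Ioo c d | F x = 0}.Finite) (hw : ∀ x ∈ Ioo c d, 0 < w x) {K : ℕ}
    (hint : ∀ g : ℝ[X], Integrable (fun x => F x * w x * g.eval x) m)
    (horth : ∀ g : ℝ[X], g.natDegree < K → ∫ x, F x * w x * g.eval x ∂m = 0) :
    ∃ S : Finset ℝ, (∀ s ∈ S, s ∈ Ioo c d ∧ F s = 0) ∧ K ≤ S.card ∧
      ∃ ε : ℝ, ε ≠ 0 ∧ ∀ z ∈ Ioo c d, 0 ≤ ε * F z * ∏ s ∈ S, (z - s) := by
  obtain ⟨S, hS, ε, hε, hs⟩ := exists_finset_sign hF hfin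
  refine ⟨S, hS, ?_, ε, hε, hs⟩
  by_contra! hK
  -- With fewer than `K` sign changes this `g` is an admissible test polynomial, yet ε F w g is
  -- nonnegative with finitely many zeros.
  set g : ℝ[X] := ∏ s ∈ S, (X - C s) with hg
  have hge : ∀ x, g.eval x = ∏ s ∈ S, (x - s) := fun x => by simp [hg, eval_prod]
  have h0 := horth g (by rwa [hg, natDegree_finsetProd_X_sub_C_eq_card])
  have hpos := integral_pos_of_finite_zeros hm hJ (h := fun x => ε * (F x * w x * g.eval x))
    (fun x hx => by
      have := mul_nonneg (hs x hx) (hw x hx).le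
      rw [hge]
      calc _ ≤ _ := this
        _ = _ := by ring)
    (by
      refine (hfin.union S.finite_toSet).subset fun x hx => ?_
      obtain ⟨hxI, hx⟩ := hx
      simp only [mul_eq_zero, hε, (hw x hxI).ne', or_false, false_or] at hx
      rcases hx with hx | hx
      · exact .inl ⟨hxI, hx⟩
      · rw [hge, Finset.prod_eq_zero_iff] at hx
        obtain ⟨s, hsS, hs0⟩ := hx
        exact .inr (by rwa [sub_eq_zero.1 hs0]))
    ((hint g).const_mul ε)
  rw [integral_const_mul, h0, mul_zero] at hpos
  exact hpos.false

theorem integrable_of_continuousOn_Icc {m : Measure ℝ} [IsFiniteMeasure m] {c d : ℝ}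
    (hm : ∀ᵐ x ∂m, x ∈ Ioo c d) {f : ℝ → ℝ} (hf : ContinuousOn f (Icc c d)) : Integrable f m := by
  have h : ∀ᵐ x ∂m, x ∈ Icc c d := hm.mono fun x hx => Ioo_subset_Icc_self hx
  rw [← Measure.restrict_eq_self_of_ae_mem h]
  exact hf.integrableOn_Icc

/-! ### Cauchy transforms on the negative axis. -/

/-- The Cauchy transform `∫ g(x) / (x - y) dm(x)`. -/
noncomputable def cauchyTransform (m : Measure ℝ) (g : ℝ → ℝ) (y : ℝ) : ℝ :=
  ∫ x, g x / (x - y) ∂m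

/-- The Stieltjes transform `∫ 1 / (x - y) dσ(y)`. -/
noncomputable def stieltjes (σ : Measure ℝ) (x : ℝ) : ℝ := ∫ y, 1 / (x - y) ∂σ

section CauchyTransform

variable {μ : Measure ℝ} [IsFiniteMeasure μ] {A : ℝ} (hμ : ∀ᵐ x ∂μ, x ∈ Ioo 0 A) {g : ℝ → ℝ}
  (hg : ContinuousOn g (Icc 0 A))

theorem continuousOn_div_sub {A : ℝ} {g : ℝ → ℝ} (hg : ContinuousOn g (Icc 0 A)) {y : ℝ}
    (hy : y < 0) : ContinuousOn (fun x => g x / (x - y)) (Icc 0 A) :=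
  hg.div (by fun_prop) fun x hx => by have := hx.1; linarith

include hμ hg

theorem continuousAt_cauchyTransform {y : ℝ} (hy : y < 0) :
    ContinuousAt (cauchyTransform μ g) y := by
  have hnear : ∀ᶠ z in nhds y, z < y / 2 := Iio_mem_nhds (by linarith)
  refine continuousAt_of_dominated (bound := fun x => |g x| / (-(y / 2))) ?_ ?_ ?_ ?_
  · filter_upwards [hnear] with z hz
    exact (integrable_of_continuousOn_Icc hμ (continuousOn_div_sub hg (by linarith))).1
  · filter_upwards [hnear] with z hz
    filter_upwards [hμ] with x hx
    rw [norm_div, Real.norm_eq_abs, Real.norm_eq_abs]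
    gcongr
    · linarith
    · exact le_trans (by linarith [hx.1]) (le_abs_self _)
  · exact integrable_of_continuousOn_Icc hμ (hg.abs.div_const _)
  · filter_upwards [hμ] with x hx
    refine ContinuousAt.div (by fun_prop) (by fun_prop) ?_
    linarith [hx.1]

/-- The resolvent identity for 1 / (x - z). It serves both to differentiate the transform and to
divide out a zero. -/
theorem cauchyTransform_sub {y z : ℝ} (hy : y < 0) (hz : z < 0) :
    cauchyTransform μ g z = cauchyTransform μ g y +
      (z - y) * cauchyTransform μ (fun x => g x / (x - y)) z := by
  have h1 := integrable_of_continuousOn_Icc hμ (continuousOn_div_sub hg hy)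
  have h2 := integrable_of_continuousOn_Icc hμ
    (continuousOn_div_sub (continuousOn_div_sub hg hy) hz)
  rw [cauchyTransform, cauchyTransform, cauchyTransform, ← integral_const_mul,
    ← integral_add h1 (h2.const_mul _)]
  refine integral_congr_ae ?_
  filter_upwards [hμ] with x hx
  have h3 : x - y ≠ 0 := by linarith [hx.1]
  have h4 : x - z ≠ 0 := by linarith [hx.1]
  field_simp
  ring

theorem hasDerivAt_cauchyTransform {y : ℝ} (hy : y < 0) :
    HasDerivAt (cauchyTransform μ g) (cauchyTransform μ (fun x => g x / (x - y)) y) y := by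
  rw [hasDerivAt_iff_tendsto_slope]
  have hc := (continuousAt_cauchyTransform hμ (continuousOn_div_sub hg hy) hy).tendsto.mono_left
    (nhdsWithin_le_nhds (s := {y}ᶜ))
  refine hc.congr' ?_
  filter_upwards [nhdsWithin_le_nhds (Iio_mem_nhds hy), self_mem_nhdsWithin] with z hz hzy
  have h : z - y ≠ 0 := sub_ne_zero.2 hzy
  rw [slope_def_field, cauchyTransform_sub hμ hg hy hz]
  field_simp
  ring

/-- Multiplication by a polynomial passes through the Cauchy transform of an orthogonal function. -/
theorem integral_mul_eval_div_sub {K : ℕ}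
    (horth : ∀ h : ℝ[X], h.natDegree < K → ∫ x, g x * h.eval x ∂μ = 0) {y : ℝ} (hy : y < 0)
    {h : ℝ[X]} (hh : h.natDegree ≤ K) :
    ∫ x, g x * h.eval x / (x - y) ∂μ = h.eval y * cauchyTransform μ g y := by
  set k := h /ₘ (X - C y) with hk
  have hmod : (X - C y) * k = h - C (h.eval y) := by
    rw [hk, X_sub_C_mul_divByMonic_eq_sub_modByMonic, modByMonic_X_sub_C_eq_C_eval]
  have hev : ∀ x, h.eval x = h.eval y + (x - y) * k.eval x := fun x => by
    have := congrArg (eval x) hmod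
    simp only [eval_mul, eval_sub, eval_X, eval_C] at this
    linarith
  have hk0 : ∫ x, g x * k.eval x ∂μ = 0 := by
    -- Constants are separate because for `K = 0` even `k = 0` fails the bound `natDegree < K`.
    by_cases h0 : h.natDegree = 0
    · rw [natDegree_eq_zero] at h0
      obtain ⟨c, rfl⟩ := h0
      have : k = 0 := by
        rw [eval_C, sub_self] at hmod
        exact (mul_eq_zero.1 hmod).resolve_left (X_sub_C_ne_zero y)
      simp [this]
    · refine horth k ?_
      rw [hk, natDegree_divByMonic _ (monic_X_sub_C y), natDegree_X_sub_C]
      omega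
  have h1 := integrable_of_continuousOn_Icc hμ (continuousOn_div_sub hg hy)
  have h2 : Integrable (fun x => g x * k.eval x) μ :=
    integrable_of_continuousOn_Icc hμ (hg.mul k.continuousOn)
  calc ∫ x, g x * h.eval x / (x - y) ∂μ
      = ∫ x, (h.eval y * (g x / (x - y)) + g x * k.eval x) ∂μ := by
        refine integral_congr_ae ?_
        filter_upwards [hμ] with x hx
        have h3 : x - y ≠ 0 := by linarith [hx.1]
        rw [hev x]
        field_simp
    _ = _ := by
        rw [integral_add (h1.const_mul _) h2, hk0, add_zero, integral_const_mul, cauchyTransform]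

/-- The zeros of a Cauchy transform can be divided out; each of them yields one more orthogonality
relation. -/
theorem exists_weight_of_zeros {K : ℕ}
    (horth : ∀ h : ℝ[X], h.natDegree < K → ∫ x, g x * h.eval x ∂μ = 0) (S : Finset ℝ)
    (hS : ∀ s ∈ S, s < 0 ∧ cauchyTransform μ g s = 0) :
    ∃ w : ℝ → ℝ, ContinuousOn w (Icc 0 A) ∧ (∀ x ∈ Icc 0 A, 0 < w x) ∧
      (∀ h : ℝ[X], h.natDegree < K + S.card → ∫ x, g x * w x * h.eval x ∂μ = 0) ∧
      ∀ z < 0, cauchyTransform μ g z =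
        (∏ s ∈ S, (z - s)) * cauchyTransform μ (fun x => g x * w x) z := by
  induction S using Finset.induction_on with
  | empty => exact ⟨fun _ => 1, continuousOn_const, by simp, by simpa using horth, by simp⟩
  | insert s S hs ih =>
    obtain ⟨w, hw, hw0, ho, hz⟩ := ih fun t ht => hS t (Finset.mem_insert_of_mem ht)
    obtain ⟨hs0, hsz⟩ := hS s (Finset.mem_insert_self s S)
    have hgw : ContinuousOn (fun x => g x * w x) (Icc 0 A) := hg.mul hw
    have hsz' : cauchyTransform μ (fun x => g x * w x) s = 0 := by
      rw [hz s hs0] at hsz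
      refine (mul_eq_zero.1 hsz).resolve_left (Finset.prod_ne_zero_iff.2 fun t ht h0 => ?_)
      exact hs (by rwa [sub_eq_zero.1 h0])
    refine ⟨fun x => w x / (x - s), continuousOn_div_sub hw hs0,
      fun x hx => div_pos (hw0 x hx) (by linarith [hx.1]), fun h hh => ?_, fun z hz0 => ?_⟩
    · rw [Finset.card_insert_of_notMem hs] at hh
      have := integral_mul_eval_div_sub hμ hgw ho hs0 (h := h) (by omega)
      rw [hsz', mul_zero] at this
      rw [← this]
      congr 1; ext x; ring
    · rw [hz z hz0, cauchyTransform_sub hμ hgw hs0 hz0, hsz', zero_add, Finset.prod_insert hs]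
      simp only [mul_div_assoc]
      ring

end CauchyTransform

/-! ### Zero counting for a mixed orthogonality system on the line. -/

section Line

variable {μ : Measure ℝ} [IsFiniteMeasure μ] [NullSingletonClass μ] (hμ0 : μ ≠ 0) {A : ℝ}
  (hμ : ∀ᵐ x ∂μ, x ∈ Ioo 0 A) {p : ℝ[X]} (hp : p ≠ 0) {w : ℝ → ℝ}
  (hw : ContinuousOn w (Icc 0 A)) (hw0 : ∀ x ∈ Ioo 0 A, 0 < w x)

include hμ0 hμ hp hw hw0

theorem exists_sign_changes_polynomial {K : ℕ}
    (horth : ∀ h : ℝ[X], h.natDegree < K → ∫ x, p.eval x * w x * h.eval x ∂μ = 0) :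
    ∃ S : Finset ℝ, (∀ s ∈ S, s ∈ Ioo 0 A ∧ p.eval s = 0) ∧ K ≤ S.card ∧
      ∃ ε : ℝ, ε ≠ 0 ∧ ∀ z ∈ Ioo 0 A, 0 ≤ ε * p.eval z * ∏ s ∈ S, (z - s) := by
  refine exists_sign_changes hμ0 hμ p.continuousOn ?_ hw0 (fun g => ?_) horth
  · exact (p.rootSet_finite ℝ).subset fun x hx => by
      rw [mem_rootSet]
      exact ⟨hp, by simpa using hx.2⟩
  · exact integrable_of_continuousOn_Icc hμ ((p.continuousOn.mul hw).mul g.continuousOn)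

theorem le_natDegree_of_orthogonal {K : ℕ}
    (horth : ∀ h : ℝ[X], h.natDegree < K → ∫ x, p.eval x * w x * h.eval x ∂μ = 0) :
    K ≤ p.natDegree := by
  obtain ⟨S, hS, hK, -⟩ := exists_sign_changes_polynomial hμ0 hμ hp hw hw0 horth
  exact hK.trans (card_le_degree_of_subset_roots fun s hs => by
    rw [mem_roots hp]; exact (hS s hs).2)

/-- Since deg p ≤ K, p(y) times the transform at y equals ∫ p² w / (x - y) dμ, which is positive. -/
theorem cauchyTransform_ne_zero {K : ℕ} (hK : p.natDegree ≤ K)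
    (horth : ∀ h : ℝ[X], h.natDegree < K → ∫ x, p.eval x * w x * h.eval x ∂μ = 0) {y : ℝ}
    (hy : y < 0) : cauchyTransform μ (fun x => p.eval x * w x) y ≠ 0 := by
  have hg : ContinuousOn (fun x => p.eval x * w x) (Icc 0 A) := p.continuousOn.mul hw
  have h1 := integral_mul_eval_div_sub hμ hg horth hy hK
  have h2 := integral_pos_of_finite_zeros hμ0 hμ (h := fun x => p.eval x * w x * p.eval x / (x - y))
    (fun x hx => by
      have h3 : 0 ≤ p.eval x ^ 2 * w x := mul_nonneg (sq_nonneg _) (hw0 x hx).le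
      exact div_nonneg (h3.trans_eq (by ring)) (by linarith [hx.1]))
    ((p.rootSet_finite ℝ).subset fun x hx => by
      obtain ⟨hxI, hx⟩ := hx
      have h3 : x - y ≠ 0 := by linarith [hxI.1]
      rw [mem_rootSet]
      refine ⟨hp, ?_⟩
      simpa [h3, (hw0 x hxI).ne'] using hx)
    (integrable_of_continuousOn_Icc hμ (continuousOn_div_sub (hg.mul p.continuousOn) hy))
  intro h0
  rw [h1, h0, mul_zero] at h2
  exact h2.false

/-- Dividing out deg p + 1 zeros would make p orthogonal to more powers than its degree allows. -/
theorem finite_zeros_cauchyTransform {K : ℕ}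
    (horth : ∀ h : ℝ[X], h.natDegree < K → ∫ x, p.eval x * w x * h.eval x ∂μ = 0) :
    {y | y < 0 ∧ cauchyTransform μ (fun x => p.eval x * w x) y = 0}.Finite := by
  by_contra hinf
  have hg : ContinuousOn (fun x => p.eval x * w x) (Icc 0 A) := p.continuousOn.mul hw
  obtain ⟨S, hS, hcard⟩ := Set.Infinite.exists_subset_card_eq hinf (p.natDegree + 1)
  obtain ⟨v, hv, hv0, ho, -⟩ := exists_weight_of_zeros hμ hg horth S
    fun s hs => hS hs
  have := le_natDegree_of_orthogonal hμ0 hμ hp (w := fun x => w x * v x) (hw.mul hv)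
    (fun x hx => mul_pos (hw0 x hx) (hv0 x (Ioo_subset_Icc_self hx))) (K := K + S.card)
    (fun h hh => by
      rw [← ho h hh]
      congr 1; ext x; ring)
  omega

variable {σ : Measure ℝ} [IsFiniteMeasure σ] [NullSingletonClass σ] (hσ0 : σ ≠ 0) {c d : ℝ}
  (hd : d < 0) (hσ : ∀ᵐ x ∂σ, x ∈ Ioo c d) {M N δ : ℕ} (hMN : N + δ ≤ M + 1)
  (horth : ∀ h : ℝ[X], h.natDegree < M → ∫ x, p.eval x * w x * h.eval x ∂μ = 0)
  (horth' : ∀ h : ℝ[X], h.natDegree < N →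
    ∫ x, p.eval x * w x * (X ^ δ * h).eval x * stieltjes σ x ∂μ = 0)

omit [NullSingletonClass μ] [NullSingletonClass σ] hμ0 hp hw0 hw in
theorem integral_mul_stieltjes {f : ℝ → ℝ} (hf : ContinuousOn f (Icc 0 A)) (hd : d < 0)
    (hσ : ∀ᵐ x ∂σ, x ∈ Ioo c d) :
    ∫ x, f x * stieltjes σ x ∂μ = ∫ y, cauchyTransform μ f y ∂σ := by
  have h1 : ∀ᵐ x ∂μ, x ∈ Icc 0 A := hμ.mono fun x hx => Ioo_subset_Icc_self hx
  have h2 : ∀ᵐ x ∂σ, x ∈ Icc c d := hσ.mono fun x hx => Ioo_subset_Icc_self hx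
  have hint : Integrable (Function.uncurry fun x y => f x / (x - y)) (μ.prod σ) := by
    rw [← Measure.restrict_eq_self_of_ae_mem h1, ← Measure.restrict_eq_self_of_ae_mem h2,
      Measure.prod_restrict]
    refine ContinuousOn.integrableOn_compact (isCompact_Icc.prod isCompact_Icc) ?_
    refine ContinuousOn.div (hf.comp continuousOn_fst fun q hq => hq.1) (by fun_prop) ?_
    intro q hq
    have := hq.1.1
    have := hq.2.2
    linarith
  simp only [stieltjes, cauchyTransform]
  rw [← integral_integral_swap hint]
  congr 1; ext x
  rw [← integral_const_mul]
  congr 1; ext y; ring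

include hσ0 hd hσ hMN horth horth'

/-- Fubini turns the mixed conditions into integrals against σ. The bound `hMN` keeps the degree of
X^δ h at most `M`, so this factor can be pulled out of the transform, which is thus orthogonal to
degrees below `N`. -/
theorem exists_sign_changes_cauchyTransform :
    ∃ S : Finset ℝ,
      (∀ s ∈ S, s ∈ Ioo c d ∧ cauchyTransform μ (fun x => p.eval x * w x) s = 0) ∧ N ≤ S.card ∧
      ∃ ε : ℝ, ε ≠ 0 ∧ ∀ z ∈ Ioo c d,
        0 ≤ ε * cauchyTransform μ (fun x => p.eval x * w x) z * ∏ s ∈ S, (z - s) := by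
  have hg : ContinuousOn (fun x => p.eval x * w x) (Icc 0 A) := p.continuousOn.mul hw
  have hc : ContinuousOn (cauchyTransform μ fun x => p.eval x * w x) (Icc c d) := fun y hy =>
    (continuousAt_cauchyTransform hμ hg (hy.2.trans_lt hd)).continuousWithinAt
  -- The sign is put into the weight because y < 0 on the support of σ.
  refine exists_sign_changes hσ0 hσ (w := fun y => (-y) ^ δ) (hc.mono Ioo_subset_Icc_self)
    ((finite_zeros_cauchyTransform hμ0 hμ hp hw hw0 horth).subset fun y hy =>
      ⟨hy.1.2.trans hd, hy.2⟩)
    (fun y hy => pow_pos (by linarith [hy.2]) δ) (fun h => ?_) (fun h hh => ?_)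
  · exact integrable_of_continuousOn_Icc hσ ((hc.mul (by fun_prop)).mul h.continuousOn)
  · have hcont : ContinuousOn (fun x => p.eval x * w x * (X ^ δ * h).eval x) (Icc 0 A) :=
      hg.mul (X ^ δ * h).continuousOn
    have h1 := horth' h hh
    rw [integral_mul_stieltjes hμ hcont hd hσ] at h1
    have hdeg : (X ^ δ * h).natDegree ≤ M := by
      have := natDegree_mul_le (p := (X : ℝ[X]) ^ δ) (q := h)
      rw [natDegree_X_pow] at this
      omega
    have h2 : ∀ᵐ y ∂σ, cauchyTransform μ (fun x => p.eval x * w x) y * (-y) ^ δ * h.eval y =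
        (-1) ^ δ * cauchyTransform μ (fun x => p.eval x * w x * (X ^ δ * h).eval x) y := by
      filter_upwards [hσ] with y hy
      rw [cauchyTransform, cauchyTransform,
        integral_mul_eval_div_sub hμ hg horth (hy.2.trans hd) hdeg, cauchyTransform,
        eval_mul, eval_pow, eval_X, neg_pow]
      ring
    rw [integral_congr_ae h2, integral_const_mul, h1, mul_zero]

theorem exists_weight_of_sign_changes :
    ∃ S : Finset ℝ, N ≤ S.card ∧
      (∃ ε : ℝ, ε ≠ 0 ∧ ∀ z ∈ Ioo c d,
        0 ≤ ε * cauchyTransform μ (fun x => p.eval x * w x) z * ∏ s ∈ S, (z - s)) ∧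
      (∀ s ∈ S, s ∈ Ioo c d) ∧
      ∃ v : ℝ → ℝ, ContinuousOn v (Icc 0 A) ∧ (∀ x ∈ Ioo 0 A, 0 < v x) ∧
      (∀ h : ℝ[X], h.natDegree < M + S.card → ∫ x, p.eval x * v x * h.eval x ∂μ = 0) ∧
      ∀ z < 0, cauchyTransform μ (fun x => p.eval x * w x) z =
        (∏ s ∈ S, (z - s)) * cauchyTransform μ (fun x => p.eval x * v x) z := by
  have hg : ContinuousOn (fun x => p.eval x * w x) (Icc 0 A) := p.continuousOn.mul hw
  obtain ⟨S, hS, hN, hε⟩ := exists_sign_changes_cauchyTransform hμ0 hμ hp hw hw0 hσ0 hd hσ hMN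
    horth horth'
  obtain ⟨v, hv, hv0, ho, hz⟩ := exists_weight_of_zeros hμ hg horth S
    fun s hs => ⟨(hS s hs).1.2.trans hd, (hS s hs).2⟩
  refine ⟨S, hN, hε, fun s hs => (hS s hs).1, fun x => w x * v x, hw.mul hv,
    fun x hx => mul_pos (hw0 x hx) (hv0 x (Ioo_subset_Icc_self hx)), fun h hh => ?_,
    fun z hz0 => ?_⟩
  · rw [← ho h hh]
    congr 1; ext x; ring
  · rw [hz z hz0]
    simp only [mul_assoc]

theorem add_le_natDegree_of_orthogonal : M + N ≤ p.natDegree := by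
  obtain ⟨S, hN, -, -, v, hv, hv0, ho, -⟩ := exists_weight_of_sign_changes hμ0 hμ hp hw hw0 hσ0 hd
    hσ hMN horth horth'
  have := le_natDegree_of_orthogonal hμ0 hμ hp hv hv0 ho
  omega

/-- The sign changes use up all but at most one degree of p, so the cofactor `r` is at most linear.
A double zero would be a zero of `r`, and then `r` either adds a forbidden sign change inside (0, A)
or contributes a simple zero outside it. -/
theorem eval_derivative_ne_zero_of_orthogonal (hdeg : p.natDegree ≤ M + N + 1) {x : ℝ}
    (hpx : p.eval x = 0) : p.derivative.eval x ≠ 0 := by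
  intro hpx'
  obtain ⟨T, hN, -, -, v, hv, hv0, ho, -⟩ := exists_weight_of_sign_changes hμ0 hμ hp hw hw0 hσ0 hd
    hσ hMN horth horth'
  obtain ⟨S, hS, hK, ε, hε, hs⟩ := exists_sign_changes_polynomial hμ0 hμ hp hv hv0 ho
  obtain ⟨r, hr⟩ : (∏ s ∈ S, (X - C s)) ∣ p :=
    Finset.prod_dvd_of_isRelPrime
      (fun s _ t _ hst => (pairwise_coprime_X_sub_C Function.injective_id hst).isRelPrime)
      fun s hs => dvd_iff_isRoot.2 (hS s hs).2
  have hmon : (∏ s ∈ S, (X - C s)).Monic := monic_prod_of_monic _ _ fun s _ => monic_X_sub_C s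
  have hr0 : r ≠ 0 := by rintro rfl; exact hp (by rw [hr, mul_zero])
  have hrdeg : r.natDegree ≤ 1 := by
    have := congrArg natDegree hr
    rw [hmon.natDegree_mul' hr0, natDegree_finsetProd_X_sub_C_eq_card] at this
    omega
  have hev : ∀ z, p.eval z = (∏ s ∈ S, (z - s)) * r.eval z := fun z => by
    rw [hr, eval_mul, eval_prod]; simp
  have hrx : r.eval x = 0 := by
    by_cases hxS : x ∈ S
    · have h1 : p = (X - C x) * ((∏ s ∈ S.erase x, (X - C s)) * r) := by
        rw [← mul_assoc, Finset.mul_prod_erase S (fun s => X - C s) hxS, ← hr]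
      have h2 := hpx'
      rw [h1, derivative_mul] at h2
      simp only [derivative_sub, derivative_X, derivative_C, sub_zero, one_mul, eval_add, eval_mul,
        eval_sub, eval_X, eval_C, sub_self, zero_mul, add_zero, eval_prod, mul_eq_zero,
        Finset.prod_eq_zero_iff] at h2
      rcases h2 with ⟨s, hs1, hs2⟩ | h2
      · rw [sub_eq_zero] at hs2
        exact (Finset.ne_of_mem_erase hs1 hs2.symm).elim
      · exact h2
    · rw [hev] at hpx
      refine (mul_eq_zero.1 hpx).resolve_left (Finset.prod_ne_zero_iff.2 fun t ht h0 => ?_)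
      exact hxS (by rwa [sub_eq_zero.1 h0])
  obtain ⟨q, hq⟩ := dvd_iff_isRoot.2 hrx
  have hq0 : q ≠ 0 := by rintro rfl; exact hr0 (by rw [hq, mul_zero])
  have hqdeg : q.natDegree = 0 := by
    have := congrArg natDegree hq
    rw [(monic_X_sub_C x).natDegree_mul' hq0, natDegree_X_sub_C] at this
    omega
  obtain ⟨k, rfl⟩ := natDegree_eq_zero.1 hqdeg
  have hk : k ≠ 0 := by rintro rfl; simp at hq0
  have hev' : ∀ z, p.eval z = (∏ s ∈ S, (z - s)) * ((z - x) * k) := fun z => by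
    rw [hev, hq]; simp
  by_cases hxA : x ∈ Ioo 0 A
  · exact hk (eq_zero_of_sign_change hxA S hε (H := fun _ => k) continuousAt_const fun z hz => by
      rw [← hev']; exact hs z hz)
  · have hP : (∏ s ∈ S, (x - s)) ≠ 0 := Finset.prod_ne_zero_iff.2 fun t ht h0 =>
      hxA (by rw [sub_eq_zero.1 h0]; exact (hS t ht).1)
    rw [hr, hq, derivative_mul, derivative_mul] at hpx'
    simp only [derivative_sub, derivative_X, derivative_C, sub_zero, one_mul, eval_add, eval_mul,
      eval_sub, eval_X, eval_C, sub_self, zero_mul, mul_zero, zero_add, add_zero, eval_prod,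
      mul_eq_zero, hP, hk, or_self] at hpx'

/-- After division by the zeros in `S`, a double zero y can be divided out once more. This gives at
least M + N + 1 ≥ deg p orthogonality relations, so what remains does not vanish at y; the sign
pattern (inside) or the derivative (outside) contradicts this. -/
theorem deriv_cauchyTransform_ne_zero_of_orthogonal (hdeg : p.natDegree ≤ M + N + 1) {y : ℝ}
    (hy : y < 0) (hy0 : cauchyTransform μ (fun x => p.eval x * w x) y = 0) :
    cauchyTransform μ (fun x => p.eval x * w x / (x - y)) y ≠ 0 := by
  intro hy'
  obtain ⟨S, hN, ⟨ε, hε, hs⟩, hS, v, hv, hv0, ho, hz⟩ := exists_weight_of_sign_changes hμ0 hμ hp hw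
    hw0 hσ0 hd hσ hMN horth horth'
  have hgw : ContinuousOn (fun x => p.eval x * w x) (Icc 0 A) := p.continuousOn.mul hw
  have hgv : ContinuousOn (fun x => p.eval x * v x) (Icc 0 A) := p.continuousOn.mul hv
  have hder : HasDerivAt (fun z => (∏ s ∈ S, (z - s)) *
      cauchyTransform μ (fun x => p.eval x * v x) z) 0 y := by
    have := hasDerivAt_cauchyTransform hμ hgw hy
    rw [hy'] at this
    refine this.congr_of_eventuallyEq ?_
    filter_upwards [Iio_mem_nhds hy] with z hz0 using (hz z hz0).symm
  have hv_y : cauchyTransform μ (fun x => p.eval x * v x) y = 0 := by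
    by_cases hyS : y ∈ S
    · have h1 : HasDerivAt (fun z => (∏ s ∈ S, (z - s)) *
          cauchyTransform μ (fun x => p.eval x * v x) z)
          ((∏ s ∈ S.erase y, (y - s)) * cauchyTransform μ (fun x => p.eval x * v x) y) y := by
        have h2 : ∀ z, (∏ s ∈ S, (z - s)) = (z - y) * ∏ s ∈ S.erase y, (z - s) := fun z =>
          (Finset.mul_prod_erase S _ hyS).symm
        simp only [h2]
        have h3 : DifferentiableAt ℝ (fun z => ∏ s ∈ S.erase y, (z - s)) y := by fun_prop
        have h4 := (((hasDerivAt_id y).sub_const y).mul h3.hasDerivAt).mul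
          (hasDerivAt_cauchyTransform hμ hgv hy)
        refine h4.congr_deriv ?_
        simp
      have h2 := h1.unique hder
      refine (mul_eq_zero.1 h2).resolve_left (Finset.prod_ne_zero_iff.2 fun t ht h0 => ?_)
      exact Finset.ne_of_mem_erase ht (sub_eq_zero.1 h0).symm
    · rw [hz y hy] at hy0
      refine (mul_eq_zero.1 hy0).resolve_left (Finset.prod_ne_zero_iff.2 fun t ht h0 => ?_)
      exact hyS (by rwa [sub_eq_zero.1 h0])
  have hH : ∀ z < 0, cauchyTransform μ (fun x => p.eval x * v x) z =
      (z - y) * cauchyTransform μ (fun x => p.eval x * (v x / (x - y))) z := fun z hz0 => by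
    rw [cauchyTransform_sub hμ hgv hy hz0, hv_y, zero_add]
    simp only [mul_div_assoc]
  have hne : cauchyTransform μ (fun x => p.eval x * (v x / (x - y))) y ≠ 0 := by
    refine cauchyTransform_ne_zero hμ0 hμ hp (continuousOn_div_sub hv hy)
      (fun x hx => div_pos (hv0 x hx) (by linarith [hx.1])) (K := M + S.card + 1) (by omega)
      (fun h hh => ?_) hy
    have := integral_mul_eval_div_sub hμ hgv ho hy (h := h) (by omega)
    rw [hv_y, mul_zero] at this
    rw [← this]
    congr 1; ext x; ring
  have hcont : ContinuousAt (cauchyTransform μ (fun x => p.eval x * (v x / (x - y)))) y :=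
    continuousAt_cauchyTransform hμ (p.continuousOn.mul (continuousOn_div_sub hv hy)) hy
  by_cases hyI : y ∈ Ioo c d
  · refine hne (eq_zero_of_sign_change hyI S hε hcont fun z hzI => ?_)
    have hz0 := hzI.2.trans hd
    rw [← hH z hz0, ← hz z hz0]
    exact hs z hzI
  · have hP : (∏ s ∈ S, (y - s)) ≠ 0 := Finset.prod_ne_zero_iff.2 fun t ht h0 =>
      hyI (by rw [sub_eq_zero.1 h0]; exact hS t ht)
    have h3 : DifferentiableAt ℝ (fun z => ∏ s ∈ S, (z - s)) y := by fun_prop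
    have h4 := h3.hasDerivAt.mul (hasDerivAt_cauchyTransform hμ hgv hy)
    have h5 := h4.unique hder
    simp only [hv_y, mul_zero, zero_add] at h5
    simp only [mul_div_assoc] at h5
    exact (mul_ne_zero hP hne) h5

end Line

/-! ### Averaging over the cube roots of unity. -/

section Contract

variable {R : Type*} [CommRing R]

theorem contract_three_X_pow (i : ℕ) :
    contract 3 (X ^ i : R[X]) = if 3 ∣ i then X ^ (i / 3) else 0 := by
  split_ifs with h
  · obtain ⟨j, rfl⟩ := h
    rw [pow_mul, Nat.mul_div_cancel_left _ (by norm_num), ← expand_X (R := R) 3, ← map_pow]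
    exact contract_expand (p := 3) (by norm_num)
  · ext m
    rw [coeff_contract (by norm_num), coeff_X_pow, coeff_zero, if_neg]
    rintro rfl
    exact h ⟨m, mul_comm _ _⟩

theorem contract_three_C_mul (a : R) (P : R[X]) :
    contract 3 (C a * P) = C a * contract 3 P := by
  ext m
  simp [coeff_contract]

end Contract

theorem cubeRoot_eq_pow (k : ℕ) : cubeRoot k = cubeRoot 1 ^ k := by
  rw [cubeRoot, cubeRoot, ← Complex.exp_nat_mul]
  congr 1
  push_cast
  ring

theorem isPrimitiveRoot_cubeRoot_one : IsPrimitiveRoot (cubeRoot 1) 3 := by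
  have := Complex.isPrimitiveRoot_exp 3 (by norm_num)
  rw [cubeRoot]
  convert this using 2
  push_cast
  ring

theorem sum_cubeRoot_pow (n : ℕ) :
    ∑ k ∈ Finset.range 3, cubeRoot k ^ n = if 3 ∣ n then 3 else 0 := by
  have hk : ∀ k, cubeRoot k ^ n = (cubeRoot 1 ^ n) ^ k := fun k => by
    rw [cubeRoot_eq_pow k, ← pow_mul, ← pow_mul, mul_comm]
  rw [Finset.sum_congr rfl fun k _ => hk k]
  split_ifs with h
  · rw [(isPrimitiveRoot_cubeRoot_one.pow_eq_one_iff_dvd n).2 h]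
    simp
  · have hcop : Nat.Coprime n 3 :=
      (Nat.coprime_comm.1 ((Nat.Prime.coprime_iff_not_dvd Nat.prime_three).2 h))
    exact (isPrimitiveRoot_cubeRoot_one.pow_of_coprime n hcop).geom_sum_eq_zero (by norm_num)

theorem sum_eval_cubeRoot_mul (P : ℂ[X]) (t : ℂ) :
    ∑ k ∈ Finset.range 3, P.eval (cubeRoot k * t) = 3 * (contract 3 P).eval (t ^ 3) := by
  induction P using Polynomial.induction_on' with
  | add P Q hP hQ =>
    simp only [eval_add, contract_add (p := 3) (by norm_num), Finset.sum_add_distrib, hP, hQ]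
    ring
  | monomial n a =>
    rw [← C_mul_X_pow_eq_monomial, contract_three_C_mul, contract_three_X_pow]
    simp only [eval_mul, eval_C, eval_pow, eval_X, mul_pow]
    rw [← Finset.mul_sum, ← Finset.sum_mul, sum_cubeRoot_pow]
    split_ifs with h
    · obtain ⟨j, rfl⟩ := h
      rw [Nat.mul_div_cancel_left _ (by norm_num), eval_pow, eval_X, ← pow_mul]
      ring
    · simp

/-! ### Transfer of the weights and integrals by t ↦ t³. -/

section CubeMeasure

/-- The image of the measure `s(t) dt` on `J` under `t ↦ t ^ 3`. -/
noncomputable def cubeMeasure (J : Set ℝ) (s : ℝ → ℝ) : Measure ℝ :=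
  ((volume.restrict J).withDensity fun t => ENNReal.ofReal (s t)).map fun t => t ^ 3

theorem strictMono_cube : StrictMono fun t : ℝ => t ^ 3 := Odd.strictMono_pow (by decide)

theorem measurableEmbedding_cube : MeasurableEmbedding fun t : ℝ => t ^ 3 :=
  (by fun_prop : Continuous fun t : ℝ => t ^ 3).measurableEmbedding strictMono_cube.injective

variable {J : Set ℝ} {s : ℝ → ℝ}

theorem integral_cubeMeasure {E : Type*} [NormedAddCommGroup E] [NormedSpace ℝ E]
    (hJ : MeasurableSet J) (hs : IntegrableOn s J) (h0 : ∀ t ∈ J, 0 ≤ s t) (f : ℝ → E) :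
    ∫ x, f x ∂cubeMeasure J s = ∫ t in J, s t • f (t ^ 3) := by
  rw [cubeMeasure, measurableEmbedding_cube.integral_map,
    integral_withDensity_eq_integral_toReal_smul₀ hs.aemeasurable.ennreal_ofReal (by simp)]
  refine setIntegral_congr_fun hJ fun t ht => ?_
  simp only [ENNReal.toReal_ofReal (h0 t ht)]

theorem isFiniteMeasure_cubeMeasure (hs : IntegrableOn s J) :
    IsFiniteMeasure (cubeMeasure J s) := by
  have := isFiniteMeasure_withDensity_ofReal hs.2
  rw [cubeMeasure]
  infer_instance

theorem nullSingletonClass_cubeMeasure : NullSingletonClass (cubeMeasure J s) := by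
  refine ⟨fun x => ?_⟩
  rw [cubeMeasure, measurableEmbedding_cube.map_apply]
  refine withDensity_absolutelyContinuous _ _ (Measure.absolutelyContinuous_of_le
    Measure.restrict_le_self ?_)
  exact Set.Subsingleton.measure_zero
    (fun a ha b hb => strictMono_cube.injective (ha.trans hb.symm)) _

theorem cubeMeasure_ne_zero (hJ : MeasurableSet J) (hs : IntegrableOn s J)
    (h0 : ∀ t ∈ J, 0 ≤ s t) (hne : ¬ ∀ᵐ t ∂volume.restrict J, s t = 0) :
    cubeMeasure J s ≠ 0 := by
  rw [cubeMeasure, Ne, Measure.map_eq_zero_iff measurableEmbedding_cube.measurable.aemeasurable,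
    withDensity_eq_zero_iff hs.aemeasurable.ennreal_ofReal]
  intro h
  apply hne
  filter_upwards [h, ae_restrict_mem hJ] with t ht htJ
  exact le_antisymm (ENNReal.ofReal_eq_zero.1 ht) (h0 t htJ)

theorem ae_cubeMeasure_mem_Ioo {u v : ℝ} :
    ∀ᵐ x ∂cubeMeasure (Ioo u v) s, x ∈ Ioo (u ^ 3) (v ^ 3) := by
  rw [cubeMeasure, measurableEmbedding_cube.ae_map_iff]
  refine (withDensity_absolutelyContinuous _ _).ae_le ?_
  filter_upwards [ae_restrict_mem measurableSet_Ioo] with t ht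
  exact ⟨strictMono_cube ht.1, strictMono_cube ht.2⟩

end CubeMeasure

theorem continuousOn_stieltjes {σ : Measure ℝ} [IsFiniteMeasure σ] {c d : ℝ} (hd : d < 0)
    (hσ : ∀ᵐ y ∂σ, y ∈ Ioo c d) {A : ℝ} : ContinuousOn (stieltjes σ) (Icc 0 A) := by
  refine continuousOn_of_dominated (bound := fun _ => 1 / (-d)) ?_ ?_ (integrable_const _) ?_
  · intro x hx
    refine (integrable_of_continuousOn_Icc hσ (continuousOn_const.div (by fun_prop) ?_)).1
    intro y hy
    linarith [hx.1, hy.2]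
  · intro x hx
    filter_upwards [hσ] with y hy
    have h1 : 0 < x - y := by linarith [hx.1, hy.2]
    rw [Real.norm_of_nonneg (by positivity)]
    exact one_div_le_one_div_of_le (by linarith) (by linarith [hx.1, hy.2])
  · filter_upwards [hσ] with y hy
    refine continuousOn_const.div (by fun_prop) fun x hx => ?_
    linarith [hx.1, hy.2]

/-- The factor z² is the source of the exponent k + 2 in `RealOrthogonal`. -/
theorem nikishinF_eq_stieltjes {a b : ℝ} (hab : a < b) {s₂ : ℝ → ℝ}
    (hs₂_nonneg : ∀ t ∈ Icc (-b) (-a), 0 ≤ s₂ t)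
    (hs₂_int : IntegrableOn s₂ (Icc (-b) (-a))) {z : ℂ} {x : ℝ} (hz : z ^ 3 = x) :
    nikishinF a b s₂ z = z ^ 2 * (stieltjes (cubeMeasure (Ioo (-b) (-a)) s₂) x : ℝ) := by
  rw [nikishinF, stieltjes, integral_cubeMeasure measurableSet_Ioo
    (hs₂_int.mono_set Ioo_subset_Icc_self) (fun t ht => hs₂_nonneg t (Ioo_subset_Icc_self ht)),
    intervalIntegral.integral_of_le (by linarith), integral_Ioc_eq_integral_Ioo, hz,
    ← integral_complex_ofReal]
  congr 2
  ext t
  rw [smul_eq_mul]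
  push_cast
  ring

section Star

variable {α : ℝ} (hα : 0 < α) {s₁ : ℂ → ℂ}
  (hs₁_nonneg : ∀ t ∈ Ioo (0 : ℝ) α, 0 ≤ (s₁ t).re ∧ (s₁ t).im = 0)
  (hs₁_int : IntegrableOn (fun t : ℝ => s₁ t) (Ioo 0 α))
  (hs₁_symm : ∀ z ∈ star3 (Ioo 0 α), s₁ (cubeRoot 1 * z) = cubeRoot 2 * s₁ z)

theorem apply_cubeRoot_mul (hs₁_symm : ∀ z ∈ star3 (Ioo 0 α), s₁ (cubeRoot 1 * z) =
    cubeRoot 2 * s₁ z) {k : ℕ} (hk : k < 3) {t : ℝ} (ht : t ∈ Ioo 0 α) :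
    s₁ (cubeRoot k * t) = cubeRoot (2 * k) * s₁ t := by
  induction k with
  | zero => simp [cubeRoot]
  | succ k ih =>
    rw [add_comm k 1, cubeRoot_add, mul_assoc, hs₁_symm _ ⟨k, by omega, t, ht, rfl⟩,
      ih (by omega), ← mul_assoc, ← cubeRoot_add]
    congr 2
    ring

include hα hs₁_nonneg hs₁_int hs₁_symm

/-- Reduction of integrals along the star to integrals over the real line. -/
theorem starIntegral_eq_integral_contract (P : ℂ[X]) {h : ℝ → ℝ}
    (hh : ContinuousOn h (Icc 0 (α ^ 3))) {G : ℂ → ℂ}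
    (hG : ∀ k < 3, ∀ t ∈ Ioo 0 α, G (cubeRoot k * (t : ℂ)) =
      P.eval (cubeRoot k * (t : ℂ)) * (h (t ^ 3) : ℂ) * s₁ (cubeRoot k * (t : ℂ))) :
    starIntegral α G =
      3 * ∫ x : ℝ, (contract 3 P).eval (x : ℂ) * (h x : ℂ)
        ∂cubeMeasure (Ioo 0 α) fun t => (s₁ t).re := by
  have hre : ∀ t ∈ Ioo 0 α, s₁ (t : ℂ) = ((s₁ t).re : ℂ) := fun t ht =>
    Complex.ext rfl (by simp [(hs₁_nonneg t ht).2])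
  -- The factor from the direction of the ray cancels the one from the symmetry of s₁.
  have hcub : ∀ k, cubeRoot k * cubeRoot (2 * k) = 1 := fun k => by
    rw [← cubeRoot_add, cubeRoot_eq_pow, show k + 2 * k = 3 * k by ring, pow_mul,
      cubeRoot_pow_three, one_pow]
  have hterm : ∀ k ∈ Finset.range 3, cubeRoot k * ∫ t in (0 : ℝ)..α, G (cubeRoot k * (t : ℂ)) =
      ∫ t in Ioo 0 α, P.eval (cubeRoot k * (t : ℂ)) * (h (t ^ 3) : ℂ) * s₁ t := by
    intro k hk
    rw [intervalIntegral.integral_of_le hα.le, integral_Ioc_eq_integral_Ioo, ← integral_const_mul]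
    refine setIntegral_congr_fun measurableSet_Ioo fun t ht => ?_
    have hk := Finset.mem_range.1 hk
    change cubeRoot k * G (cubeRoot k * (t : ℂ)) = _
    rw [hG k hk t ht, apply_cubeRoot_mul hs₁_symm hk ht]
    linear_combination (P.eval (cubeRoot k * (t : ℂ)) * (h (t ^ 3) : ℂ) * s₁ t) * hcub k
  have hint : ∀ k ∈ Finset.range 3, Integrable
      (fun t : ℝ => P.eval (cubeRoot k * (t : ℂ)) * (h (t ^ 3) : ℂ) * s₁ t)
      (volume.restrict (Ioo 0 α)) := by
    intro k _
    have hc : ContinuousOn (fun t : ℝ => P.eval (cubeRoot k * (t : ℂ)) * (h (t ^ 3) : ℂ))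
        (Icc 0 α) := by
      refine ContinuousOn.mul (Continuous.continuousOn ?_) ?_
      · exact P.continuous.comp (by fun_prop)
      · refine Complex.continuous_ofReal.comp_continuousOn (hh.comp (by fun_prop) fun t ht => ?_)
        exact ⟨pow_nonneg ht.1 3, pow_le_pow_left₀ ht.1 ht.2 3⟩
    have hi : IntegrableOn (fun t : ℝ => s₁ t) (Icc 0 α) :=
      by rwa [integrableOn_Icc_iff_integrableOn_Ioo]
    exact (hi.continuousOn_mul hc isCompact_Icc).mono_set Ioo_subset_Icc_self
  rw [starIntegral, Finset.sum_congr rfl hterm, ← integral_finsetSum _ hint,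
    integral_cubeMeasure measurableSet_Ioo (s := fun t : ℝ => (s₁ t).re) hs₁_int.re fun t ht => (hs₁_nonneg t ht).1,
    ← integral_const_mul]
  refine setIntegral_congr_fun measurableSet_Ioo fun t ht => ?_
  rw [← Finset.sum_mul, ← Finset.sum_mul, sum_eval_cubeRoot_mul, hre t ht, Complex.real_smul,
    Complex.ofReal_re]
  push_cast
  ring

end Star

/-! ### The real orthogonality system and its decomposition mod 3. -/

/-- The orthogonality conditions of index `n` for a real polynomial, after the substitution
`x = t ^ 3`. -/
def RealOrthogonal (μ σ : Measure ℝ) (n : ℕ) (R : ℝ[X]) : Prop :=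
  (∀ k < (n + 1) / 2, ∫ x, (contract 3 (R * X ^ k)).eval x ∂μ = 0) ∧
  (∀ k < n / 2, ∫ x, (contract 3 (R * X ^ (k + 2))).eval x * stieltjes σ x ∂μ = 0)

theorem contract_X_pow_mul_expand (r k : ℕ) (p : ℝ[X]) :
    contract 3 (X ^ r * expand ℝ 3 p * X ^ k) =
      if 3 ∣ r + k then X ^ ((r + k) / 3) * p else 0 := by
  rw [show X ^ r * expand ℝ 3 p * X ^ k = X ^ (r + k) * expand ℝ 3 p by ring,
    contract_mul_expand (by norm_num), contract_three_X_pow]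
  split_ifs <;> simp

/-- Only exponents k ≡ κ mod 3 give a condition, and (K + 2 - κ) / 3 counts those below `K`. -/
theorem forall_contract_iff (L : ℝ[X] → ℝ) (hL : L 0 = 0) {r κ e : ℕ} (hrκ : r + κ = 3 * e)
    (hκ : κ < 3) (K : ℕ) (p : ℝ[X]) :
    (∀ k < K, L (contract 3 (X ^ r * expand ℝ 3 p * X ^ k)) = 0) ↔
      ∀ j < (K + 2 - κ) / 3, L (X ^ (e + j) * p) = 0 := by
  constructor
  · intro h j hj
    have := h (κ + 3 * j) (by omega)
    rwa [contract_X_pow_mul_expand, if_pos (by omega),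
      show (r + (κ + 3 * j)) / 3 = e + j by omega] at this
  · intro h k hk
    rw [contract_X_pow_mul_expand]
    split_ifs with hd
    · obtain ⟨i, hi⟩ := hd
      rw [show (r + k) / 3 = e + (i - e) by omega]
      exact h _ (by omega)
    · exact hL

/-- The orthogonality conditions for a polynomial of the form `t ^ r * p (t ^ 3)`. -/
theorem exists_realOrthogonal_iff (μ σ : Measure ℝ) (n : ℕ) {r : ℕ} (hr : r < 3) :
    ∃ e δ M N, e = (r + 2) / 3 ∧ N + δ ≤ M + 1 ∧ n ≤ 3 * (M + N) + r ∧
      (r = n % 3 → M + N = n / 3) ∧ ∀ p : ℝ[X], RealOrthogonal μ σ n (X ^ r * expand ℝ 3 p) ↔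
        (∀ j < M, ∫ x, p.eval x * x ^ e * x ^ j ∂μ = 0) ∧
        (∀ j < N, ∫ x, p.eval x * x ^ e * x ^ δ * stieltjes σ x * x ^ j ∂μ = 0) := by
  have key : ∀ {κ e κ' δ : ℕ}, r + κ = 3 * e → κ < 3 → r + 2 + κ' = 3 * (e + δ) → κ' < 3 →
      ∀ p : ℝ[X], RealOrthogonal μ σ n (X ^ r * expand ℝ 3 p) ↔
        (∀ j < ((n + 1) / 2 + 2 - κ) / 3, ∫ x, p.eval x * x ^ e * x ^ j ∂μ = 0) ∧
        (∀ j < (n / 2 + 2 - κ') / 3,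
          ∫ x, p.eval x * x ^ e * x ^ δ * stieltjes σ x * x ^ j ∂μ = 0) := by
    intro κ e κ' δ h1 h2 h3 h4 p
    have h5 := forall_contract_iff (fun P => ∫ x, P.eval x ∂μ) (by simp) h1 h2 ((n + 1) / 2) p
    have h6 := forall_contract_iff (fun P => ∫ x, P.eval x * stieltjes σ x ∂μ) (by simp) h3 h4
      (n / 2) p
    rw [RealOrthogonal]
    have h7 : ∀ k, X ^ r * expand ℝ 3 p * X ^ (k + 2) = X ^ (r + 2) * expand ℝ 3 p * X ^ k :=
      fun k => by ring
    simp only [h7]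
    rw [h5, h6]
    simp only [eval_mul, eval_pow, eval_X]
    refine and_congr (forall₂_congr fun j _ => ?_) (forall₂_congr fun j _ => ?_)
    · rw [show (fun x : ℝ => x ^ (e + j) * p.eval x) = fun x => p.eval x * x ^ e * x ^ j from
        funext fun x => by ring]
    · rw [show (fun x : ℝ => x ^ (e + δ + j) * p.eval x * stieltjes σ x) =
        fun x => p.eval x * x ^ e * x ^ δ * stieltjes σ x * x ^ j from funext fun x => by ring]
  interval_cases r
  · exact ⟨0, 1, _, _, by norm_num, by omega, by omega, fun h => by
        rcases (by omega : n % 6 = 0 ∨ n % 6 = 3) with h | h <;> omega,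
      key (κ := 0) (κ' := 1) (by norm_num) (by norm_num) (by norm_num) (by norm_num)⟩
  · exact ⟨1, 0, _, _, by norm_num, by omega, by omega, fun h => by
        rcases (by omega : n % 6 = 1 ∨ n % 6 = 4) with h | h <;> omega,
      key (κ := 2) (κ' := 0) (by norm_num) (by norm_num) (by norm_num) (by norm_num)⟩
  · exact ⟨1, 1, _, _, by norm_num, by omega, by omega, fun h => by
        rcases (by omega : n % 6 = 2 ∨ n % 6 = 5) with h | h <;> omega,
      key (κ := 1) (κ' := 2) (by norm_num) (by norm_num) (by norm_num) (by norm_num)⟩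

theorem realOrthogonal_mono {μ σ : Measure ℝ} {n m : ℕ} (hmn : m ≤ n) {R : ℝ[X]}
    (h : RealOrthogonal μ σ n R) : RealOrthogonal μ σ m R :=
  ⟨fun k hk => h.1 k (by omega), fun k hk => h.2 k (by omega)⟩

theorem realOrthogonal_X_mul {μ σ : Measure ℝ} {n : ℕ} {R : ℝ[X]}
    (h : RealOrthogonal μ σ (n + 2) R) : RealOrthogonal μ σ n (X * R) := by
  refine ⟨fun k hk => ?_, fun k hk => ?_⟩
  · rw [show X * R * X ^ k = R * X ^ (k + 1) by ring]
    exact h.1 _ (by omega)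
  · rw [show X * R * X ^ (k + 2) = R * X ^ (k + 1 + 2) by ring]
    exact h.2 _ (by omega)

/-- The conditions on X R omit only k = 0 in each family; index 2 supplies exactly these. -/
theorem realOrthogonal_of_X_mul {μ σ : Measure ℝ} {n : ℕ} {R : ℝ[X]}
    (h2 : RealOrthogonal μ σ 2 R) (h : RealOrthogonal μ σ n (X * R)) :
    RealOrthogonal μ σ (n + 2) R := by
  refine ⟨fun k hk => ?_, fun k hk => ?_⟩
  · rcases k with - | k
    · exact h2.1 0 (by norm_num)
    · rw [show R * X ^ (k + 1) = X * R * X ^ k by ring]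
      exact h.1 _ (by omega)
  · rcases k with - | k
    · exact h2.2 0 (by norm_num)
    · rw [show R * X ^ (k + 1 + 2) = X * R * X ^ (k + 2) by ring]
      exact h.2 _ (by omega)

theorem coeff_divX_iterate (R : ℝ[X]) (r m : ℕ) : (divX^[r] R).coeff m = R.coeff (m + r) := by
  induction r generalizing m with
  | zero => rfl
  | succ r ih => rw [Function.iterate_succ_apply', coeff_divX, ih]; congr 1; ring

/-- Each condition sees only the coefficients of `R` in one residue class mod 3, so each component
inherits the conditions separately. -/
theorem realOrthogonal_component {μ σ : Measure ℝ} {n r : ℕ} (hr : r < 3) {R : ℝ[X]}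
    (h : RealOrthogonal μ σ n R) :
    RealOrthogonal μ σ n (X ^ r * expand ℝ 3 (contract 3 (divX^[r] R))) := by
  have key : ∀ k, 3 ∣ r + k → contract 3 (X ^ r * expand ℝ 3 (contract 3 (divX^[r] R)) * X ^ k) =
      contract 3 (R * X ^ k) := by
    intro k hk
    rw [contract_X_pow_mul_expand, if_pos hk]
    ext m
    rw [coeff_contract (by norm_num), coeff_X_pow_mul', coeff_mul_X_pow',
      coeff_contract (by norm_num), coeff_divX_iterate]
    obtain ⟨i, hi⟩ := hk
    rw [hi, Nat.mul_div_cancel_left _ (by norm_num)]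
    by_cases him : i ≤ m
    · rw [if_pos him, if_pos (by omega)]
      congr 1
      omega
    · rw [if_neg him, if_neg (by omega)]
  refine ⟨fun k hk => ?_, fun k hk => ?_⟩
  · by_cases hd : 3 ∣ r + k
    · rw [key k hd, h.1 k hk]
    · rw [contract_X_pow_mul_expand, if_neg hd]
      simp
  · by_cases hd : 3 ∣ r + (k + 2)
    · rw [key _ hd, h.2 k hk]
    · rw [contract_X_pow_mul_expand, if_neg hd]
      simp

section LineSystem

variable {μ σ : Measure ℝ} [IsFiniteMeasure μ] [IsFiniteMeasure σ] {A c d : ℝ}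
  (hμ : ∀ᵐ x ∂μ, x ∈ Ioo 0 A) (hd : d < 0) (hσ : ∀ᵐ x ∂σ, x ∈ Ioo c d)

include hμ in
theorem integral_mul_eval_eq_zero {f : ℝ → ℝ} (hf : ContinuousOn f (Icc 0 A)) {K : ℕ}
    (h0 : ∀ j < K, ∫ x, f x * x ^ j ∂μ = 0) {h : ℝ[X]} (hh : h.natDegree < K) :
    ∫ x, f x * h.eval x ∂μ = 0 := by
  have he : ∀ x, f x * h.eval x = ∑ i ∈ Finset.range K, h.coeff i * (f x * x ^ i) := fun x => by
    rw [eval_eq_sum_range' hh, Finset.mul_sum]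
    exact Finset.sum_congr rfl fun i _ => by ring
  simp only [he]
  have hi : ∀ i ∈ Finset.range K, Integrable (fun x => h.coeff i * (f x * x ^ i)) μ := fun i _ =>
    integrable_of_continuousOn_Icc hμ (continuousOn_const.mul (hf.mul (by fun_prop)))
  rw [integral_finsetSum _ hi]
  refine Finset.sum_eq_zero fun i hi => ?_
  rw [integral_const_mul, h0 i (Finset.mem_range.1 hi), mul_zero]

include hμ hd hσ in
theorem realOrthogonal_linear (a b : ℝ) {n : ℕ} {R S : ℝ[X]} (hR : RealOrthogonal μ σ n R)
    (hS : RealOrthogonal μ σ n S) : RealOrthogonal μ σ n (C a * R + C b * S) := by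
  have he : ∀ k x, (contract 3 ((C a * R + C b * S) * X ^ k)).eval x =
      a * (contract 3 (R * X ^ k)).eval x + b * (contract 3 (S * X ^ k)).eval x := fun k x => by
    rw [add_mul, contract_add (by norm_num), mul_assoc, mul_assoc, contract_three_C_mul,
      contract_three_C_mul]
    simp
  have hc := continuousOn_stieltjes hd hσ (A := A)
  refine ⟨fun k hk => ?_, fun k hk => ?_⟩
  · simp only [he]
    rw [integral_add, integral_const_mul, integral_const_mul, hR.1 k hk, hS.1 k hk]
    · ring
    all_goals exact (integrable_of_continuousOn_Icc hμ (Polynomial.continuousOn _)).const_mul _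
  · have he' : ∀ x, (contract 3 ((C a * R + C b * S) * X ^ (k + 2))).eval x * stieltjes σ x =
        a * ((contract 3 (R * X ^ (k + 2))).eval x * stieltjes σ x) +
          b * ((contract 3 (S * X ^ (k + 2))).eval x * stieltjes σ x) := fun x => by
      rw [he]; ring
    simp only [he']
    rw [integral_add, integral_const_mul, integral_const_mul, hR.2 k hk, hS.2 k hk]
    · ring
    all_goals exact (integrable_of_continuousOn_Icc hμ
      ((Polynomial.continuousOn _).mul hc)).const_mul _

variable [NullSingletonClass μ] [NullSingletonClass σ] (hμ0 : μ ≠ 0) (hσ0 : σ ≠ 0)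

include hμ hd hσ hμ0 hσ0

theorem zeros_of_realOrthogonal {n r : ℕ} (hr : r < 3) {p : ℝ[X]} (hp : p ≠ 0)
    (h : RealOrthogonal μ σ n (X ^ r * expand ℝ 3 p)) :
    n ≤ 3 * p.natDegree + r ∧ (3 * p.natDegree + r ≤ n + 3 →
      (∀ x, p.eval x = 0 → p.derivative.eval x ≠ 0) ∧
      ∀ y < 0, cauchyTransform μ (fun x => p.eval x * x ^ ((r + 2) / 3)) y = 0 →
        cauchyTransform μ (fun x => p.eval x * x ^ ((r + 2) / 3) / (x - y)) y ≠ 0) := by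
  obtain ⟨e, δ, M, N, he, hMN, hn, -, hiff⟩ := exists_realOrthogonal_iff μ σ n hr
  obtain ⟨h1, h2⟩ := (hiff p).1 h
  rw [← he]
  have hw : ContinuousOn (fun x : ℝ => x ^ e) (Icc 0 A) := by fun_prop
  have hw0 : ∀ x ∈ Ioo 0 A, (0 : ℝ) < x ^ e := fun x hx => pow_pos hx.1 e
  have hc := continuousOn_stieltjes hd hσ (A := A)
  have ho : ∀ h : ℝ[X], h.natDegree < M → ∫ x, p.eval x * x ^ e * h.eval x ∂μ = 0 := fun h hh =>
    integral_mul_eval_eq_zero hμ (p.continuousOn.mul hw) h1 hh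
  have ho' : ∀ h : ℝ[X], h.natDegree < N →
      ∫ x, p.eval x * x ^ e * (X ^ δ * h).eval x * stieltjes σ x ∂μ = 0 := fun h hh => by
    have := integral_mul_eval_eq_zero hμ
      (((p.continuousOn.mul hw).mul (by fun_prop : ContinuousOn (fun x : ℝ => x ^ δ) _)).mul hc)
      h2 hh
    rw [← this]
    congr 1; ext x
    simp only [eval_mul, eval_pow, eval_X, Pi.mul_apply]
    ring
  refine ⟨?_, fun hdeg => ⟨fun x hx => ?_, fun y hy hy0 => ?_⟩⟩
  · have := add_le_natDegree_of_orthogonal hμ0 hμ hp hw hw0 hσ0 hd hσ hMN ho ho'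
    omega
  · exact eval_derivative_ne_zero_of_orthogonal hμ0 hμ hp hw hw0 hσ0 hd hσ hMN ho ho' (by omega) hx
  · exact deriv_cauchyTransform_ne_zero_of_orthogonal hμ0 hμ hp hw hw0 hσ0 hd hσ hMN ho ho'
      (by omega) hy hy0

/-- Normality of the index: a nonzero component mod 3 would have degree at least `n` in t, against
the vanishing of these coefficients. -/
theorem eq_zero_of_realOrthogonal {n : ℕ} {R : ℝ[X]} (h : RealOrthogonal μ σ n R)
    (hdeg : ∀ i, n ≤ i → R.coeff i = 0) : R = 0 := by
  have key : ∀ r < 3, contract 3 (divX^[r] R) = 0 := by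
    intro r hr
    by_contra hp
    have h1 := (zeros_of_realOrthogonal hμ hd hσ hμ0 hσ0 hr hp (realOrthogonal_component hr h)).1
    have h2 := leadingCoeff_ne_zero.2 hp
    rw [leadingCoeff, coeff_contract (by norm_num), coeff_divX_iterate] at h2
    exact h2 (hdeg _ (by omega))
  ext i
  have h1 := congrArg (fun P => P.coeff (i / 3)) (key (i % 3) (Nat.mod_lt _ (by norm_num)))
  simp only [coeff_zero] at h1
  rw [coeff_contract (by norm_num), coeff_divX_iterate,
    show i / 3 * 3 + i % 3 = i by omega] at h1
  simpa using h1

theorem exists_realOrthogonal (n : ℕ) : ∃ q : ℝ[X], q.Monic ∧ q.natDegree = n / 3 ∧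
    RealOrthogonal μ σ n (X ^ (n % 3) * expand ℝ 3 q) := by
  obtain ⟨e, δ, M, N, he, hMN, hn, hMN', hiff⟩ :=
    exists_realOrthogonal_iff μ σ n (Nat.mod_lt n (by norm_num : 3 > 0))
  have hlin : ∀ f : ℝ → ℝ, ContinuousOn f (Icc 0 A) →
      ∃ L : ℝ[X] →ₗ[ℝ] ℝ, ∀ P, L P = ∫ x, P.eval x * f x ∂μ := by
    intro f hf
    have hi : ∀ P : ℝ[X], Integrable (fun x => P.eval x * f x) μ := fun P =>
      integrable_of_continuousOn_Icc hμ (P.continuousOn.mul hf)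
    refine ⟨{ toFun := fun P => ∫ x, P.eval x * f x ∂μ, map_add' := ?_, map_smul' := ?_ },
      fun P => rfl⟩
    · intro P R
      simp only [eval_add, add_mul]
      exact integral_add (hi P) (hi R)
    · intro a P
      simp only [eval_smul, smul_eq_mul, mul_assoc, integral_const_mul, RingHom.id_apply]
  have hc := continuousOn_stieltjes hd hσ (A := A)
  choose L₁ hL₁ using fun i : Fin M => hlin (fun x => x ^ e * x ^ (i : ℕ)) (by fun_prop)
  choose L₂ hL₂ using fun i : Fin N => hlin (fun x => x ^ e * x ^ δ * stieltjes σ x * x ^ (i : ℕ))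
    (((by fun_prop : ContinuousOn (fun x : ℝ => x ^ e * x ^ δ) _).mul hc).mul (by fun_prop))
  let Φ : ℝ[X] →ₗ[ℝ] ((Fin M → ℝ) × (Fin N → ℝ)) := (LinearMap.pi L₁).prod (LinearMap.pi L₂)
  let Φ' := (Φ.comp (degreeLT ℝ (M + N + 1)).subtype).comp
    (degreeLTEquiv ℝ (M + N + 1)).symm.toLinearMap
  obtain ⟨v, hv, hv0⟩ : ∃ v, Φ' v = 0 ∧ v ≠ 0 := by
    have : ¬ Function.Injective Φ' := by
      intro hinj
      have := LinearMap.finrank_le_finrank_of_injective hinj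
      simp at this
    rw [← LinearMap.ker_eq_bot] at this
    obtain ⟨v, hv, h0⟩ := Submodule.exists_mem_ne_zero_of_ne_bot this
    exact ⟨v, hv, h0⟩
  set R : ℝ[X] := ((degreeLTEquiv ℝ (M + N + 1)).symm v : ℝ[X]) with hR
  have hR0 : R ≠ 0 := by simpa [hR] using hv0
  have hRdeg : R.natDegree < M + N + 1 := by
    have := ((degreeLTEquiv ℝ (M + N + 1)).symm v).2
    rw [mem_degreeLT] at this
    exact (natDegree_lt_iff_degree_lt hR0).2 this
  have hΦ : Φ R = 0 := hv
  have hlead : R.leadingCoeff⁻¹ ≠ 0 := inv_ne_zero (leadingCoeff_ne_zero.2 hR0)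
  have hΦ2 : Φ (R.leadingCoeff⁻¹ • R) = 0 := by rw [map_smul, hΦ, smul_zero]
  have hmonic : (R.leadingCoeff⁻¹ • R).Monic := by
    rw [smul_eq_C_mul, mul_comm]
    exact monic_mul_leadingCoeff_inv hR0
  have horth : RealOrthogonal μ σ n (X ^ (n % 3) * expand ℝ 3 (R.leadingCoeff⁻¹ • R)) := by
    refine (hiff _).2 ⟨fun j hj => ?_, fun j hj => ?_⟩
    · have := congrFun (congrArg Prod.fst hΦ2) ⟨j, hj⟩
      have h2 := hL₁ ⟨j, hj⟩ (R.leadingCoeff⁻¹ • R)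
      rw [show L₁ ⟨j, hj⟩ (R.leadingCoeff⁻¹ • R) = 0 from this] at h2
      simp only [mul_assoc] at h2 ⊢
      exact h2.symm
    · have := congrFun (congrArg Prod.snd hΦ2) ⟨j, hj⟩
      have h2 := hL₂ ⟨j, hj⟩ (R.leadingCoeff⁻¹ • R)
      rw [show L₂ ⟨j, hj⟩ (R.leadingCoeff⁻¹ • R) = 0 from this] at h2
      simp only [mul_assoc] at h2 ⊢
      exact h2.symm
  refine ⟨_, hmonic, ?_, horth⟩
  -- The dimension count gives degree at most M + N = n / 3, and zero counting gives the reverse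
  -- inequality.
  have h1 := (zeros_of_realOrthogonal hμ hd hσ hμ0 hσ0 (Nat.mod_lt n (by norm_num))
    hmonic.ne_zero horth).1
  have h2 := natDegree_smul_le R.leadingCoeff⁻¹ R
  have h3 := hMN' rfl
  omega

end LineSystem

/-! ### Back from the line to the star. -/

theorem interlacing_of_simple_zeros {I J : Set ℝ} (hI : I.OrdConnected) (h0 : (0 : ℝ) ∉ J)
    (hIJ : ∀ t ∈ I, t ^ 3 ∈ J) {f g f' g' : ℝ → ℝ} (hf : ∀ y ∈ J, HasDerivAt f (f' y) y)
    (hg : ∀ y ∈ J, HasDerivAt g (g' y) y)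
    (hs : ∀ y ∈ J, ∀ A B : ℝ, (A ≠ 0 ∨ B ≠ 0) → A * f y + B * g y = 0 → A * f' y + B * g' y ≠ 0)
    {F G : ℂ → ℂ} (hF : ∀ (z : ℂ) (y : ℝ), y ∈ J → z ^ 3 = y → (F z = 0 ↔ f y = 0))
    (hG : ∀ (z : ℂ) (y : ℝ), y ∈ J → z ^ 3 = y → (G z = 0 ↔ g y = 0)) :
    (∀ (z : ℂ) (y : ℝ), y ∈ J → z ^ 3 = y → ¬ (F z = 0 ∧ G z = 0)) ∧
      OneZeroBetween F G I ∧ OneZeroBetween G F I := by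
  have hW : ∀ y ∈ J, f y * g' y ≠ f' y * g y := fun y hy => wronskian_ne_zero_of_simple (hs y hy)
  have hcube : ∀ t : ℝ, HasDerivAt (fun t : ℝ => t ^ 3) (3 * t ^ 2) t := fun t => by
    simpa using hasDerivAt_pow 3 t
  have hfd : ∀ t ∈ I, HasDerivAt (fun t => f (t ^ 3)) (f' (t ^ 3) * (3 * t ^ 2)) t := fun t ht =>
    HasDerivAt.comp (h₂ := f) (h := fun t : ℝ => t ^ 3) t (hf _ (hIJ t ht)) (hcube t)
  have hgd : ∀ t ∈ I, HasDerivAt (fun t => g (t ^ 3)) (g' (t ^ 3) * (3 * t ^ 2)) t := fun t ht =>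
    HasDerivAt.comp (h₂ := g) (h := fun t : ℝ => t ^ 3) t (hg _ (hIJ t ht)) (hcube t)
  have hW' : ∀ t ∈ I, f (t ^ 3) * (g' (t ^ 3) * (3 * t ^ 2)) ≠
      f' (t ^ 3) * (3 * t ^ 2) * g (t ^ 3) := fun t ht h => by
    have ht0 : t ≠ 0 := by
      rintro rfl
      have := hIJ 0 ht
      norm_num at this
      exact h0 this
    have h3 : 3 * t ^ 2 ≠ 0 := by positivity
    refine hW _ (hIJ t ht) (mul_right_cancel₀ h3 ?_)
    linear_combination h
  have hF' : ∀ t ∈ I, F t = 0 ↔ f (t ^ 3) = 0 := fun t ht => hF _ _ (hIJ t ht) (by push_cast; rfl)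
  have hG' : ∀ t ∈ I, G t = 0 ↔ g (t ^ 3) = 0 := fun t ht => hG _ _ (hIJ t ht) (by push_cast; rfl)
  have hsub : ∀ {x y}, x ∈ I → y ∈ I → ∀ {t}, t ∈ Ioo x y → t ∈ I := fun hx hy t ht =>
    hI.out hx hy (Ioo_subset_Icc_self ht)
  refine ⟨fun z y hy hz h => ?_, fun x y ⟨hx, hy, hxy, hx0, hy0, hne⟩ => ?_,
    fun x y ⟨hx, hy, hxy, hx0, hy0, hne⟩ => ?_⟩
  · have h1 := (hF z y hy hz).1 h.1
    have h2 := (hG z y hy hz).1 h.2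
    exact hW y hy (by rw [h1, h2]; ring)
  · obtain ⟨t, ht, hu⟩ := existsUnique_zero_of_wronskian_ne_zero hI hfd hgd hW' hx hy hxy
      ((hF' x hx).1 hx0) ((hF' y hy).1 hy0)
      fun t ht h => hne t ht ((hF' t (hsub hx hy ht)).2 h)
    exact ⟨t, ⟨ht.1, (hG' t (hsub hx hy ht.1)).2 ht.2⟩,
      fun u hu' => hu u ⟨hu'.1, (hG' u (hsub hx hy hu'.1)).1 hu'.2⟩⟩
  · obtain ⟨t, ht, hu⟩ := existsUnique_zero_of_wronskian_ne_zero hI hgd hfd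
      (fun t ht h => hW' t ht (by linarith)) hx hy hxy
      ((hG' x hx).1 hx0) ((hG' y hy).1 hy0)
      fun t ht h => hne t ht ((hG' t (hsub hx hy ht)).2 h)
    exact ⟨t, ⟨ht.1, (hF' t (hsub hx hy ht.1)).2 ht.2⟩,
      fun u hu' => hu u ⟨hu'.1, (hF' u (hsub hx hy hu'.1)).1 hu'.2⟩⟩

theorem interlacing_of_no_zeros {I J : Set ℝ} (hIJ : ∀ t ∈ I, t ^ 3 ∈ J) {F G : ℂ → ℂ}
    (hF : ∀ (z : ℂ) (y : ℝ), y ∈ J → z ^ 3 = y → F z ≠ 0)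
    (hG : ∀ (z : ℂ) (y : ℝ), y ∈ J → z ^ 3 = y → G z ≠ 0) :
    (∀ (z : ℂ) (y : ℝ), y ∈ J → z ^ 3 = y → ¬ (F z = 0 ∧ G z = 0)) ∧
      OneZeroBetween F G I ∧ OneZeroBetween G F I :=
  ⟨fun z y hy hz h => hF z y hy hz h.1,
    fun x _ h => (hF x _ (hIJ x h.1) (by push_cast; rfl) h.2.2.2.1).elim,
    fun x _ h => (hG x _ (hIJ x h.1) (by push_cast; rfl) h.2.2.2.1).elim⟩

theorem exists_re_im_polynomial (P : ℂ[X]) : ∃ R S : ℝ[X],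
    P = R.map Complex.ofRealHom + C Complex.I * S.map Complex.ofRealHom := by
  refine ⟨∑ i ∈ P.support, monomial i (P.coeff i).re,
    ∑ i ∈ P.support, monomial i (P.coeff i).im, ?_⟩
  ext i
  have h : ∀ u : ℂ → ℝ, u 0 = 0 →
      (∑ j ∈ P.support, monomial j (u (P.coeff j))).coeff i = u (P.coeff i) := fun u hu => by
    rw [finsetSum_coeff]
    simp only [coeff_monomial, Finset.sum_ite_eq', mem_support_iff]
    split_ifs with h
    · rfl
    · rw [not_not.1 h, hu]
  rw [coeff_add, coeff_C_mul, coeff_map, coeff_map, h _ Complex.zero_re, h _ Complex.zero_im]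
  simp [mul_comm Complex.I]

theorem eval_map_ofReal (R : ℝ[X]) (x : ℝ) :
    (R.map Complex.ofRealHom).eval (x : ℂ) = (R.eval x : ℝ) := by
  rw [eval_map]
  exact eval₂_at_apply Complex.ofRealHom x

theorem eval_map_X_pow_mul_expand (r : ℕ) (p : ℝ[X]) {z : ℂ} {y : ℝ} (hz : z ^ 3 = y) :
    ((X ^ r * expand ℝ 3 p).map Complex.ofRealHom).eval z = z ^ r * (p.eval y : ℝ) := by
  rw [Polynomial.map_mul, Polynomial.map_pow, map_X, map_expand, eval_mul, eval_pow, eval_X,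
    expand_eval, hz, eval_map_ofReal]

theorem integral_contract_re_im {μ : Measure ℝ} [IsFiniteMeasure μ] {A : ℝ}
    (hμ : ∀ᵐ x ∂μ, x ∈ Ioo 0 A) {h : ℝ → ℝ} (hh : ContinuousOn h (Icc 0 A)) (R S : ℝ[X]) (k : ℕ) :
    ∫ x : ℝ, (contract 3 ((R.map Complex.ofRealHom + C Complex.I * S.map Complex.ofRealHom) *
      X ^ k)).eval (x : ℂ) * (h x : ℂ) ∂μ =
    (∫ x, (contract 3 (R * X ^ k)).eval x * h x ∂μ : ℝ) +
      Complex.I * (∫ x, (contract 3 (S * X ^ k)).eval x * h x ∂μ : ℝ) := by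
  have hmap : ∀ T : ℝ[X], T.map Complex.ofRealHom * X ^ k = (T * X ^ k).map Complex.ofRealHom :=
    fun T => by simp
  have hint : ∀ T : ℝ[X], Integrable (fun x => (((contract 3 T).eval x * h x : ℝ) : ℂ)) μ :=
    fun T => (integrable_of_continuousOn_Icc hμ ((Polynomial.continuousOn _).mul hh)).ofReal
  rw [← integral_complex_ofReal, ← integral_complex_ofReal, ← integral_const_mul,
    ← integral_add (hint _) ((hint _).const_mul _)]
  congr 1
  ext x
  rw [add_mul, mul_assoc, hmap, hmap, contract_add (by norm_num), contract_three_C_mul,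
    ← map_contract (by norm_num), ← map_contract (by norm_num), eval_add, eval_mul, eval_C,
    eval_map_ofReal, eval_map_ofReal]
  push_cast
  ring

theorem ofReal_add_I_mul_eq_zero_iff (u v : ℝ) : (u : ℂ) + Complex.I * v = 0 ↔ u = 0 ∧ v = 0 := by
  simp [Complex.ext_iff]

section NikishinStar

variable {α a b : ℝ} (hα : 0 < α) (ha : 0 < a) (hab : a < b) {s₁ : ℂ → ℂ}
  (hs₁_nonneg : ∀ t ∈ Ioo (0 : ℝ) α, 0 ≤ (s₁ t).re ∧ (s₁ t).im = 0)
  (hs₁_int : IntegrableOn (fun t : ℝ => s₁ t) (Ioo 0 α))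
  (hs₁_symm : ∀ z ∈ star3 (Ioo 0 α), s₁ (cubeRoot 1 * z) = cubeRoot 2 * s₁ z)

include hα hs₁_nonneg hs₁_int hs₁_symm

theorem secondType_eq_cauchyTransform {r : ℕ} (hr : r < 3) (p : ℝ[X]) {z : ℂ} {y : ℝ} (hy : y < 0)
    (hz : z ^ 3 = y) :
    secondType α s₁ ((X ^ r * expand ℝ 3 p).map Complex.ofRealHom) z =
      3 * z ^ ((r + 2) % 3) * (cauchyTransform (cubeMeasure (Ioo 0 α) fun t => (s₁ t).re)
        (fun x => p.eval x * x ^ ((r + 2) / 3)) y : ℝ) := by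
  set P : ℂ[X] := (X ^ r * expand ℝ 3 p).map Complex.ofRealHom with hP
  -- The kernel 1 / (t - z) is (t² + zt + z²) / (t³ - z³). Exactly one of the exponents r, r + 1, r
  -- + 2 is divisible by 3, which leaves a single power of z.
  have hcontr : contract 3 (P * (X ^ 2 + C z * X + C (z ^ 2))) =
      C (z ^ ((r + 2) % 3)) * X ^ ((r + 2) / 3) * p.map Complex.ofRealHom := by
    have h1 : P * (X ^ 2 + C z * X + C (z ^ 2)) =
        (X ^ (r + 2) + (C z * X ^ (r + 1) + C (z ^ 2) * X ^ r)) *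
          expand ℂ 3 (p.map Complex.ofRealHom) := by
      rw [hP, Polynomial.map_mul, Polynomial.map_pow, map_X, map_expand]
      ring
    rw [h1, contract_mul_expand (by norm_num), contract_add (by norm_num),
      contract_add (by norm_num), contract_three_C_mul, contract_three_C_mul,
      contract_three_X_pow, contract_three_X_pow, contract_three_X_pow]
    interval_cases r <;> norm_num
  rw [secondType, starIntegral_eq_integral_contract hα hs₁_nonneg hs₁_int hs₁_symm
    (P * (X ^ 2 + C z * X + C (z ^ 2))) (h := fun x => 1 / (x - y))
    (continuousOn_div_sub continuousOn_const hy), mul_assoc]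
  · congr 1
    rw [cauchyTransform, ← integral_complex_ofReal, ← integral_const_mul]
    congr 1
    ext x
    rw [hcontr, eval_mul, eval_mul, eval_C, eval_pow, eval_X, eval_map_ofReal]
    push_cast
    ring
  · intro k _ t ht
    set τ : ℂ := cubeRoot k * (t : ℂ) with hτ
    have hτ3 : τ ^ 3 = (t : ℂ) ^ 3 := by rw [hτ, mul_pow, cubeRoot_pow_three, one_mul]
    have hne : (t : ℂ) ^ 3 - y ≠ 0 := by
      have h2 : t ^ 3 - y ≠ 0 := by
        have := pow_pos ht.1 3
        linarith
      exact_mod_cast h2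
    have hfac : (τ - z) * (τ ^ 2 + z * τ + z ^ 2) = (t : ℂ) ^ 3 - y := by
      rw [← hτ3, ← hz]; ring
    have hsub : τ - z ≠ 0 := by
      intro h0
      rw [h0, zero_mul] at hfac
      exact hne hfac.symm
    simp only [eval_mul, eval_add, eval_pow, eval_X, eval_C]
    push_cast
    rw [← hfac]
    have hq : τ ^ 2 + z * τ + z ^ 2 ≠ 0 := by
      intro h0
      rw [h0, mul_zero] at hfac
      exact hne hfac.symm
    rw [div_eq_mul_inv, one_div, mul_inv]
    linear_combination -(P.eval τ * (τ - z)⁻¹ * s₁ τ) * mul_inv_cancel₀ hq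

variable {s₂ : ℝ → ℝ} (hs₂_nonneg : ∀ t ∈ Icc (-b) (-a), 0 ≤ s₂ t)
  (hs₂_int : IntegrableOn s₂ (Icc (-b) (-a)))

include ha hab hs₂_nonneg hs₂_int

theorem multiOrthogonal_iff_realOrthogonal (n : ℕ) (R S : ℝ[X]) :
    MultiOrthogonal α a b s₁ s₂ n
      (R.map Complex.ofRealHom + C Complex.I * S.map Complex.ofRealHom) ↔
    RealOrthogonal (cubeMeasure (Ioo 0 α) fun t => (s₁ t).re)
      (cubeMeasure (Ioo (-b) (-a)) s₂) n R ∧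
    RealOrthogonal (cubeMeasure (Ioo 0 α) fun t => (s₁ t).re)
      (cubeMeasure (Ioo (-b) (-a)) s₂) n S := by
  have hfin : IsFiniteMeasure (cubeMeasure (Ioo 0 α) fun t => (s₁ t).re) :=
    isFiniteMeasure_cubeMeasure hs₁_int.re
  have hfin' : IsFiniteMeasure (cubeMeasure (Ioo (-b) (-a)) s₂) :=
    isFiniteMeasure_cubeMeasure (hs₂_int.mono_set Ioo_subset_Icc_self)
  have hμ := ae_cubeMeasure_mem_Ioo (s := fun t => (s₁ t).re) (u := 0) (v := α)
  rw [zero_pow (by norm_num)] at hμ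
  have hst : ContinuousOn (stieltjes (cubeMeasure (Ioo (-b) (-a)) s₂)) (Icc 0 (α ^ 3)) :=
    continuousOn_stieltjes (Odd.pow_neg (by decide) (by linarith : -a < 0)) ae_cubeMeasure_mem_Ioo
  have h1 : ∀ k, starIntegral α (fun t =>
      (R.map Complex.ofRealHom + C Complex.I * S.map Complex.ofRealHom).eval t * t ^ k * s₁ t) = 0 ↔
      (∫ x, (contract 3 (R * X ^ k)).eval x ∂cubeMeasure (Ioo 0 α) fun t => (s₁ t).re) = 0 ∧
      (∫ x, (contract 3 (S * X ^ k)).eval x ∂cubeMeasure (Ioo 0 α) fun t => (s₁ t).re) = 0 := by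
    intro k
    rw [starIntegral_eq_integral_contract hα hs₁_nonneg hs₁_int hs₁_symm
      ((R.map Complex.ofRealHom + C Complex.I * S.map Complex.ofRealHom) * X ^ k)
      (h := fun _ => 1) continuousOn_const (fun j _ t _ => by
        rw [eval_mul, eval_pow, eval_X, Complex.ofReal_one, mul_one]),
      integral_contract_re_im hμ continuousOn_const, mul_eq_zero, ofReal_add_I_mul_eq_zero_iff]
    simp
  have h2 : ∀ k, starIntegral α (fun t =>
      (R.map Complex.ofRealHom + C Complex.I * S.map Complex.ofRealHom).eval t * t ^ k *
        nikishinF a b s₂ t * s₁ t) = 0 ↔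
      (∫ x, (contract 3 (R * X ^ (k + 2))).eval x * stieltjes (cubeMeasure (Ioo (-b) (-a)) s₂) x
        ∂cubeMeasure (Ioo 0 α) fun t => (s₁ t).re) = 0 ∧
      (∫ x, (contract 3 (S * X ^ (k + 2))).eval x * stieltjes (cubeMeasure (Ioo (-b) (-a)) s₂) x
        ∂cubeMeasure (Ioo 0 α) fun t => (s₁ t).re) = 0 := by
    intro k
    rw [starIntegral_eq_integral_contract hα hs₁_nonneg hs₁_int hs₁_symm
      ((R.map Complex.ofRealHom + C Complex.I * S.map Complex.ofRealHom) * X ^ (k + 2))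
      hst (fun j _ t _ => by
        have h3 : (cubeRoot j * (t : ℂ)) ^ 3 = (t ^ 3 : ℝ) := by
          rw [mul_pow, cubeRoot_pow_three, one_mul, Complex.ofReal_pow]
        rw [nikishinF_eq_stieltjes hab hs₂_nonneg hs₂_int h3, eval_mul, eval_pow, eval_X]
        ring),
      integral_contract_re_im hμ hst, mul_eq_zero, ofReal_add_I_mul_eq_zero_iff]
    simp
  simp only [MultiOrthogonal, RealOrthogonal, h1, h2]
  constructor
  · rintro ⟨h3, h4⟩
    exact ⟨⟨fun k hk => (h3 k hk).1, fun k hk => (h4 k hk).1⟩,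
      fun k hk => (h3 k hk).2, fun k hk => (h4 k hk).2⟩
  · rintro ⟨⟨h3, h4⟩, h5, h6⟩
    exact ⟨fun k hk => ⟨h3 k hk, h5 k hk⟩, fun k hk => ⟨h4 k hk, h6 k hk⟩⟩

end NikishinStar

/-! ### Linear combinations of consecutive polynomials. -/

/-- The polynomial `p` with `t * (t ^ (n % 3) * q (t ^ 3)) = t ^ ((n + 1) % 3) * p (t ^ 3)`. -/
noncomputable def shiftedComponent (n : ℕ) (q : ℝ[X]) : ℝ[X] := if n % 3 = 2 then X * q else q

theorem X_mul_X_pow_mul_expand (n : ℕ) (q : ℝ[X]) :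
    X * (X ^ (n % 3) * expand ℝ 3 q) =
      X ^ ((n + 1) % 3) * expand ℝ 3 (shiftedComponent n q) := by
  rw [shiftedComponent]
  split_ifs with h
  · rw [h, show (n + 1) % 3 = 0 by omega, map_mul, expand_X]
    ring
  · rw [show (n + 1) % 3 = n % 3 + 1 by omega]
    ring

theorem natDegree_shiftedComponent {n : ℕ} {q : ℝ[X]} (hq : q.Monic) (hdeg : q.natDegree = n / 3) :
    (shiftedComponent n q).natDegree = (n + 1) / 3 := by
  rw [shiftedComponent]
  split_ifs with h
  · rw [natDegree_X_mul hq.ne_zero, hdeg]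
    omega
  · rw [hdeg]
    omega

theorem eval_shiftedComponent_eq_zero_iff (n : ℕ) (q : ℝ[X]) {y : ℝ} (hy : y ≠ 0) :
    (shiftedComponent n q).eval y = 0 ↔ q.eval y = 0 := by
  rw [shiftedComponent]
  split_ifs <;> simp [hy]

section Consecutive

variable {μ σ : Measure ℝ} [IsFiniteMeasure μ] [IsFiniteMeasure σ] {A c d : ℝ}
  (hμ : ∀ᵐ x ∂μ, x ∈ Ioo 0 A) (hd : d < 0) (hσ : ∀ᵐ x ∂σ, x ∈ Ioo c d)

omit [IsFiniteMeasure σ] in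
include hμ in
-- The two integrands agree unless 3 ∣ n. In that case there is an extra factor x, which leaves the
-- integral as y ≠ 0 because `q` is orthogonal to constants; this condition is present since n ≥ 1.
theorem cauchyTransform_shiftedComponent_eq_zero_iff {n : ℕ} (hn : 1 ≤ n) {q : ℝ[X]}
    (hq : RealOrthogonal μ σ n (X ^ (n % 3) * expand ℝ 3 q)) {y : ℝ} (hy : y < 0) :
    cauchyTransform μ
        (fun x => (shiftedComponent n q).eval x * x ^ (((n + 1) % 3 + 2) / 3)) y = 0 ↔
      cauchyTransform μ (fun x => q.eval x * x ^ ((n % 3 + 2) / 3)) y = 0 := by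
  rw [shiftedComponent]
  rcases (by omega : n % 3 = 0 ∨ n % 3 = 1 ∨ n % 3 = 2) with h | h | h
  · rw [h, if_neg (by norm_num), show (n + 1) % 3 = 1 by omega]
    have h0 : ∫ x, q.eval x ∂μ = 0 := by
      have := hq.1 0 (by omega)
      rw [contract_X_pow_mul_expand, if_pos (by omega), h] at this
      simpa using this
    have h1 := integral_mul_eval_div_sub hμ (g := fun x => q.eval x) (K := 1) q.continuousOn
      (fun g hg => by
        obtain ⟨k, rfl⟩ := natDegree_eq_zero.1 (Nat.lt_one_iff.1 hg)
        simp only [eval_C]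
        rw [integral_mul_const, h0, zero_mul]) hy (h := X) natDegree_X_le
    simp only [eval_X] at h1
    have h2 : cauchyTransform μ (fun x => q.eval x * x ^ ((1 + 2) / 3)) y =
        y * cauchyTransform μ (fun x => q.eval x * x ^ ((0 + 2) / 3)) y := by
      simpa [cauchyTransform] using h1
    rw [h2, mul_eq_zero, or_iff_right hy.ne]
  · rw [h, if_neg (by norm_num), show (n + 1) % 3 = 2 by omega]
  · rw [h, if_pos rfl, show (n + 1) % 3 = 0 by omega]
    have : (fun x : ℝ => (X * q).eval x * x ^ ((0 + 2) / 3)) =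
        fun x => q.eval x * x ^ ((2 + 2) / 3) := by
      ext x
      rw [eval_mul, eval_X]
      norm_num
      ring
    rw [this]

variable [NullSingletonClass μ] [NullSingletonClass σ] (hμ0 : μ ≠ 0) (hσ0 : σ ≠ 0)

include hμ hd hσ hμ0 hσ0

theorem simple_zeros_of_consecutive {n : ℕ} (hn : 2 ≤ n) {q q' : ℝ[X]} (hq : q.Monic)
    (hdeg : q.natDegree = n / 3) (hqo : RealOrthogonal μ σ n (X ^ (n % 3) * expand ℝ 3 q))
    (hq' : q'.Monic) (hdeg' : q'.natDegree = (n + 1) / 3)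
    (hqo' : RealOrthogonal μ σ (n + 1) (X ^ ((n + 1) % 3) * expand ℝ 3 q')) {B C' : ℝ}
    (hBC : B ≠ 0 ∨ C' ≠ 0) :
    (∀ x, (C B * shiftedComponent n q + C C' * q').eval x = 0 →
      (C B * shiftedComponent n q + C C' * q').derivative.eval x ≠ 0) ∧
    ∀ y < 0, cauchyTransform μ (fun x => (C B * shiftedComponent n q + C C' * q').eval x *
        x ^ (((n + 1) % 3 + 2) / 3)) y = 0 →
      cauchyTransform μ (fun x => (C B * shiftedComponent n q + C C' * q').eval x *
        x ^ (((n + 1) % 3 + 2) / 3) / (x - y)) y ≠ 0 := by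
  obtain ⟨m, rfl⟩ : ∃ m, n = m + 2 := ⟨n - 2, by omega⟩
  set R := X ^ ((m + 2) % 3) * expand ℝ 3 q with hR
  have hRmonic : R.Monic := (monic_X_pow _).mul (hq.expand (by norm_num))
  have hRdeg : R.natDegree = m + 2 := by
    rw [hR, (monic_X_pow _).natDegree_mul (hq.expand (by norm_num)), natDegree_X_pow,
      natDegree_expand, hdeg]
    omega
  set P := C B * shiftedComponent (m + 2) q + C C' * q' with hP
  have hXR := X_mul_X_pow_mul_expand (m + 2) q
  rw [← hR] at hXR
  have hcomb : X ^ ((m + 2 + 1) % 3) * expand ℝ 3 P =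
      C B * (X * R) + C C' * (X ^ ((m + 2 + 1) % 3) * expand ℝ 3 q') := by
    rw [hXR, hP, map_add, map_mul, map_mul, expand_C, expand_C]
    ring
  have horth : RealOrthogonal μ σ m (X ^ ((m + 2 + 1) % 3) * expand ℝ 3 P) := by
    rw [hcomb]
    exact realOrthogonal_linear hμ hd hσ _ _ (realOrthogonal_X_mul hqo)
      (realOrthogonal_mono (by omega) hqo')
  have hP0 : P ≠ 0 := by
    intro h0
    by_cases hB : B = 0
    · have hC : C' ≠ 0 := hBC.resolve_left (not_not.2 hB)
      rw [hP, hB, C_0, zero_mul, zero_add, mul_eq_zero, C_eq_zero] at h0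
      exact h0.elim hC hq'.ne_zero
    -- If the combination vanished, X R would be a multiple of the next polynomial. Then `R`, of
    -- degree m + 2, would satisfy the conditions of index m + 5, against normality.
    · have h1 : X * R = C 0 * R + C (-(C' / B)) * (X ^ ((m + 2 + 1) % 3) * expand ℝ 3 q') := by
        rw [h0, map_zero, mul_zero] at hcomb
        have h2 : C B⁻¹ * (C B * (X * R)) = X * R := by
          rw [← mul_assoc, ← C_mul, inv_mul_cancel₀ hB, C_1, one_mul]
        rw [← h2, eq_neg_of_add_eq_zero_left hcomb.symm, div_eq_mul_inv, C_neg, C_mul, C_0]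
        ring
      have h2 : RealOrthogonal μ σ (m + 2 + 1 + 2) R := by
        refine realOrthogonal_of_X_mul (realOrthogonal_mono (by omega) hqo) ?_
        have h3 : RealOrthogonal μ σ (m + 2 + 1) 0 := by simp [RealOrthogonal, contract]
        have h4 := realOrthogonal_linear hμ hd hσ 1 (-(C' / B)) h3 hqo'
        rw [h1]
        simpa using h4
      exact hRmonic.ne_zero (eq_zero_of_realOrthogonal hμ hd hσ hμ0 hσ0 h2 fun i hi =>
        coeff_eq_zero_of_natDegree_lt (by omega))
  have hPdeg : P.natDegree ≤ (m + 2 + 1) / 3 := by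
    refine natDegree_add_le_of_degree_le ((natDegree_C_mul_le _ _).trans ?_)
      ((natDegree_C_mul_le _ _).trans ?_)
    · exact (natDegree_shiftedComponent hq hdeg).le
    · exact hdeg'.le
  exact (zeros_of_realOrthogonal hμ hd hσ hμ0 hσ0 (Nat.mod_lt _ (by norm_num)) hP0 horth).2
    (by omega)

end Consecutive

/-! ### Identification of the multiple orthogonal polynomials. -/

section NikishinStar

variable {α a b : ℝ} (hα : 0 < α) (ha : 0 < a) (hab : a < b) {s₁ : ℂ → ℂ}
  (hs₁_nonneg : ∀ t ∈ Ioo (0 : ℝ) α, 0 ≤ (s₁ t).re ∧ (s₁ t).im = 0)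
  (hs₁_int : IntegrableOn (fun t : ℝ => s₁ t) (Ioo 0 α))
  (hs₁_symm : ∀ z ∈ star3 (Ioo 0 α), s₁ (cubeRoot 1 * z) = cubeRoot 2 * s₁ z)
  {s₂ : ℝ → ℝ} (hs₂_nonneg : ∀ t ∈ Icc (-b) (-a), 0 ≤ s₂ t)
  (hs₂_int : IntegrableOn s₂ (Icc (-b) (-a)))

include hα ha hab hs₁_nonneg hs₁_int hs₁_symm hs₂_nonneg hs₂_int

/-- The multiple orthogonal polynomials are real, of full degree, and have the symmetry of the
star. -/
theorem exists_eq_map_of_isMultiOrthPoly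
    (hμ0 : cubeMeasure (Ioo 0 α) (fun t => (s₁ t).re) ≠ 0)
    (hσ0 : cubeMeasure (Ioo (-b) (-a)) s₂ ≠ 0) {n : ℕ} {Q : ℂ[X]}
    (hQ : IsMultiOrthPoly α a b s₁ s₂ n Q) :
    ∃ q : ℝ[X], q.Monic ∧ q.natDegree = n / 3 ∧
      RealOrthogonal (cubeMeasure (Ioo 0 α) fun t => (s₁ t).re)
        (cubeMeasure (Ioo (-b) (-a)) s₂) n (X ^ (n % 3) * expand ℝ 3 q) ∧
      Q = (X ^ (n % 3) * expand ℝ 3 q).map Complex.ofRealHom := by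
  have hfin : IsFiniteMeasure (cubeMeasure (Ioo 0 α) fun t => (s₁ t).re) :=
    isFiniteMeasure_cubeMeasure hs₁_int.re
  have hfin' : IsFiniteMeasure (cubeMeasure (Ioo (-b) (-a)) s₂) :=
    isFiniteMeasure_cubeMeasure (hs₂_int.mono_set Ioo_subset_Icc_self)
  have hns : NullSingletonClass (cubeMeasure (Ioo 0 α) fun t => (s₁ t).re) :=
    nullSingletonClass_cubeMeasure
  have hns' : NullSingletonClass (cubeMeasure (Ioo (-b) (-a)) s₂) := nullSingletonClass_cubeMeasure
  have hμ := ae_cubeMeasure_mem_Ioo (s := fun t => (s₁ t).re) (u := 0) (v := α)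
  rw [zero_pow (by norm_num)] at hμ
  have hσ := ae_cubeMeasure_mem_Ioo (s := s₂) (u := -b) (v := -a)
  have hd : (-a) ^ 3 < 0 := Odd.pow_neg (by decide) (by linarith)
  obtain ⟨q, hq, hdeg, horth⟩ := exists_realOrthogonal hμ hd hσ hμ0 hσ0 n
  refine ⟨q, hq, hdeg, horth, ?_⟩
  set R := X ^ (n % 3) * expand ℝ 3 q with hR
  have hRmonic : R.Monic := (monic_X_pow _).mul (hq.expand (by norm_num))
  have hRdeg : R.natDegree = n := by
    rw [hR, (monic_X_pow _).natDegree_mul (hq.expand (by norm_num)), natDegree_X_pow,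
      natDegree_expand, hdeg]
    omega
  have hiff := multiOrthogonal_iff_realOrthogonal hα ha hab hs₁_nonneg hs₁_int hs₁_symm hs₂_nonneg
    hs₂_int n
  have hzero : RealOrthogonal (cubeMeasure (Ioo 0 α) fun t => (s₁ t).re)
      (cubeMeasure (Ioo (-b) (-a)) s₂) n 0 := by simp [RealOrthogonal, contract]
  have hle : Q.natDegree ≤ n := by
    have h1 := (hiff R 0).2 ⟨horth, hzero⟩
    rw [Polynomial.map_zero, mul_zero, add_zero] at h1
    have h2 := hQ.lowest_degree _ (hRmonic.map _) h1
    rwa [hRmonic.natDegree_map, hRdeg] at h2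
  obtain ⟨S, T, hST⟩ := exists_re_im_polynomial Q
  have ho := hQ.orthogonal
  rw [hST] at ho
  obtain ⟨hS, hT⟩ := (hiff S T).1 ho
  have hcoeff : ∀ i, Q.coeff i = (S.coeff i : ℂ) + Complex.I * T.coeff i := fun i => by
    rw [hST, coeff_add, coeff_C_mul, coeff_map, coeff_map]
    rfl
  have huniq : ∀ U : ℝ[X], RealOrthogonal (cubeMeasure (Ioo 0 α) fun t => (s₁ t).re)
      (cubeMeasure (Ioo (-b) (-a)) s₂) n U → (∀ i, n < i → U.coeff i = 0) →
      U = C (U.coeff n) * R := by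
    intro U hU hU0
    -- Subtracting a multiple of the monic `R` removes the coefficient of index n, so normality
    -- applies to the difference.
    have h1 := eq_zero_of_realOrthogonal hμ hd hσ hμ0 hσ0
      (realOrthogonal_linear hμ hd hσ 1 (-(U.coeff n)) hU horth) fun i hi => by
        rw [coeff_add, coeff_C_mul, coeff_C_mul]
        rcases hi.eq_or_lt with rfl | hi
        · have := hRmonic.coeff_natDegree
          rw [hRdeg] at this
          rw [this]
          ring
        · rw [hU0 i hi, coeff_eq_zero_of_natDegree_lt (p := R) (n := i) (by omega)]
          ring
    rw [C_1, one_mul, C_neg] at h1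
    linear_combination h1
  have hhigh : ∀ i, n < i → S.coeff i = 0 ∧ T.coeff i = 0 := fun i hi => by
    rw [← ofReal_add_I_mul_eq_zero_iff, ← hcoeff, coeff_eq_zero_of_natDegree_lt (by omega)]
  have hS' := huniq S hS fun i hi => (hhigh i hi).1
  have hT' := huniq T hT fun i hi => (hhigh i hi).2
  have hQR : Q = C (Q.coeff n) * R.map Complex.ofRealHom := by
    rw [hcoeff, C_add, C_mul]
    have hmap : ∀ u : ℝ, (C u * R).map Complex.ofRealHom =
        C (u : ℂ) * R.map Complex.ofRealHom := fun u => by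
      rw [Polynomial.map_mul Complex.ofRealHom (p := C u), map_C]
      rfl
    conv_lhs => rw [hST, hS', hT', hmap, hmap]
    ring
  have hlead := congrArg leadingCoeff hQR
  rw [hQ.monic.leadingCoeff, leadingCoeff_mul, leadingCoeff_C,
    (hRmonic.map Complex.ofRealHom).leadingCoeff, mul_one] at hlead
  rw [hQR, ← hlead, C_1, one_mul]

end NikishinStar

/-! ### The interlacing theorem. -/

theorem theorem1p1
    (α a b : ℝ) (hα : 0 < α) (ha : 0 < a) (hab : a < b)
    (s₁ : ℂ → ℂ)
    (hs₁_nonneg : ∀ t ∈ Ioo (0 : ℝ) α, 0 ≤ (s₁ t).re ∧ (s₁ t).im = 0)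
    (hs₁_int : IntegrableOn (fun t : ℝ => s₁ t) (Ioo 0 α))
    (hs₁_symm : ∀ z ∈ star3 (Ioo 0 α), s₁ (cubeRoot 1 * z) = cubeRoot 2 * s₁ z)
    (hs₁_ne : ¬ (∀ᵐ t : ℝ ∂(volume.restrict (Ioo 0 α)), s₁ (t : ℂ) = 0))
    (s₂ : ℝ → ℝ)
    (hs₂_nonneg : ∀ t ∈ Icc (-b) (-a), 0 ≤ s₂ t)
    (hs₂_int : IntegrableOn s₂ (Icc (-b) (-a)))
    (hs₂_ne : ¬ (∀ᵐ t ∂(volume.restrict (Icc (-b) (-a))), s₂ t = 0))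
    (Q : ℕ → ℂ[X]) (hQ : ∀ n, IsMultiOrthPoly α a b s₁ s₂ n (Q n))
    (n : ℕ) :
    ((¬ ∃ z ∈ star3 (Icc 0 α) \ {0}, (Q n).eval z = 0 ∧ (Q (n + 1)).eval z = 0) ∧
      OneZeroBetween (fun z => (Q n).eval z) (fun z => (Q (n + 1)).eval z) (Ioo 0 α) ∧
      OneZeroBetween (fun z => (Q (n + 1)).eval z) (fun z => (Q n).eval z) (Ioo 0 α)) ∧
    ((¬ ∃ z ∈ star3 (Icc (-b) (-a)), secondType α s₁ (Q n) z = 0 ∧ secondType α s₁ (Q (n + 1)) z = 0) ∧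
      OneZeroBetween (secondType α s₁ (Q n)) (secondType α s₁ (Q (n + 1))) (Ioo (-b) (-a)) ∧
      OneZeroBetween (secondType α s₁ (Q (n + 1))) (secondType α s₁ (Q n)) (Ioo (-b) (-a))) := by
  set μ := cubeMeasure (Ioo 0 α) fun t => (s₁ t).re
  set σ := cubeMeasure (Ioo (-b) (-a)) s₂
  have hs₂_int' : IntegrableOn s₂ (Ioo (-b) (-a)) := hs₂_int.mono_set Ioo_subset_Icc_self
  have hfin : IsFiniteMeasure μ := isFiniteMeasure_cubeMeasure hs₁_int.re
  have hfin' : IsFiniteMeasure σ := isFiniteMeasure_cubeMeasure hs₂_int'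
  have hns : NullSingletonClass μ := nullSingletonClass_cubeMeasure
  have hns' : NullSingletonClass σ := nullSingletonClass_cubeMeasure
  have hμ : ∀ᵐ x ∂μ, x ∈ Ioo 0 (α ^ 3) := by
    have := ae_cubeMeasure_mem_Ioo (s := fun t => (s₁ t).re) (u := 0) (v := α)
    rwa [zero_pow (by norm_num)] at this
  have hσ : ∀ᵐ x ∂σ, x ∈ Ioo ((-b) ^ 3) ((-a) ^ 3) := ae_cubeMeasure_mem_Ioo
  have hd : (-a) ^ 3 < 0 := Odd.pow_neg (by decide) (by linarith)
  have hμ0 : μ ≠ 0 := by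
    refine cubeMeasure_ne_zero measurableSet_Ioo hs₁_int.re (fun t ht => (hs₁_nonneg t ht).1)
      fun h => hs₁_ne ?_
    filter_upwards [h, ae_restrict_mem measurableSet_Ioo] with t ht htI
    exact Complex.ext ht (hs₁_nonneg t htI).2
  have hσ0 : σ ≠ 0 := by
    refine cubeMeasure_ne_zero measurableSet_Ioo hs₂_int'
      (fun t ht => hs₂_nonneg t (Ioo_subset_Icc_self ht)) fun h => hs₂_ne ?_
    rwa [← restrict_Ioo_eq_restrict_Icc]
  have hrep := fun m => exists_eq_map_of_isMultiOrthPoly hα ha hab hs₁_nonneg hs₁_int hs₁_symm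
    hs₂_nonneg hs₂_int hμ0 hσ0 (hQ m)
  choose q hq hdeg horth hQq using hrep
  have hcubeQ : ∀ t ∈ Ioo 0 α, t ^ 3 ∈ Ioi (0 : ℝ) := fun t ht => pow_pos ht.1 3
  have hcubeΨ : ∀ t ∈ Ioo (-b) (-a), t ^ 3 ∈ Iio (0 : ℝ) := fun t ht =>
    show t ^ 3 < 0 from Odd.pow_neg (by decide) (by linarith [ht.2])
  have hQ0 : ∀ m (z : ℂ) (y : ℝ), y ≠ 0 → z ^ 3 = y →
      ((Q m).eval z = 0 ↔ (q m).eval y = 0) := fun m z y hy hz => by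
    have hz0 : z ≠ 0 := by
      rintro rfl
      rw [zero_pow (by norm_num)] at hz
      exact hy (by exact_mod_cast hz.symm)
    rw [hQq, eval_map_X_pow_mul_expand _ _ hz, mul_eq_zero, or_iff_right (pow_ne_zero _ hz0),
      Complex.ofReal_eq_zero]
  have hΨ0 : ∀ m (z : ℂ) (y : ℝ), y < 0 → z ^ 3 = y → (secondType α s₁ (Q m) z = 0 ↔
      cauchyTransform μ (fun x => (q m).eval x * x ^ ((m % 3 + 2) / 3)) y = 0) :=
    fun m z y hy hz => by
    have hz0 : z ≠ 0 := by
      rintro rfl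
      rw [zero_pow (by norm_num)] at hz
      exact hy.ne (by exact_mod_cast hz.symm)
    rw [hQq, secondType_eq_cauchyTransform hα hs₁_nonneg hs₁_int hs₁_symm
      (Nat.mod_lt m (by norm_num)) _ hy hz, mul_eq_zero,
      or_iff_right (mul_ne_zero (by norm_num) (pow_ne_zero _ hz0)), Complex.ofReal_eq_zero]
  have hgoal :
      ((∀ (z : ℂ) (y : ℝ), y ∈ Ioi (0 : ℝ) → z ^ 3 = y →
          ¬ ((Q n).eval z = 0 ∧ (Q (n + 1)).eval z = 0)) ∧
        OneZeroBetween (fun z => (Q n).eval z) (fun z => (Q (n + 1)).eval z) (Ioo 0 α) ∧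
        OneZeroBetween (fun z => (Q (n + 1)).eval z) (fun z => (Q n).eval z) (Ioo 0 α)) ∧
      ((∀ (z : ℂ) (y : ℝ), y ∈ Iio (0 : ℝ) → z ^ 3 = y →
          ¬ (secondType α s₁ (Q n) z = 0 ∧ secondType α s₁ (Q (n + 1)) z = 0)) ∧
        OneZeroBetween (secondType α s₁ (Q n)) (secondType α s₁ (Q (n + 1))) (Ioo (-b) (-a)) ∧
        OneZeroBetween (secondType α s₁ (Q (n + 1))) (secondType α s₁ (Q n)) (Ioo (-b) (-a))) := by
    rcases Nat.lt_or_ge n 2 with hn | hn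
    -- For n < 2 the index n - 2 is unavailable, but both polynomials are powers of z and neither Ψ
    -- vanishes where z³ < 0.
    · have hone : ∀ m < 3, q m = 1 := fun m hm =>
        (hq m).natDegree_eq_zero.1 (by rw [hdeg]; omega)
      have hQne : ∀ m < 3, ∀ (z : ℂ) (y : ℝ), y ∈ Ioi (0 : ℝ) → z ^ 3 = y → (Q m).eval z ≠ 0 :=
        fun m hm z y hy hz => by
        rw [Ne, hQ0 m z y hy.ne' hz, hone m hm]
        simp
      have hΨne : ∀ m < 3, ∀ (z : ℂ) (y : ℝ), y ∈ Iio (0 : ℝ) → z ^ 3 = y →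
          secondType α s₁ (Q m) z ≠ 0 := fun m hm z y hy hz => by
        rw [Ne, hΨ0 m z y hy hz]
        refine cauchyTransform_ne_zero hμ0 hμ (hq m).ne_zero (w := fun x => x ^ ((m % 3 + 2) / 3))
          (by fun_prop) (fun x hx => pow_pos hx.1 _) (K := 0) ?_ (fun h hh => by omega) hy
        rw [hdeg]
        omega
      exact ⟨interlacing_of_no_zeros hcubeQ (hQne n (by omega)) (hQne (n + 1) (by omega)),
        interlacing_of_no_zeros hcubeΨ (hΨne n (by omega)) (hΨne (n + 1) (by omega))⟩
    · have hsimple := fun B C' hBC => simple_zeros_of_consecutive hμ hd hσ hμ0 hσ0 hn (hq n) (hdeg n)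
        (horth n) (hq (n + 1)) (hdeg (n + 1)) (horth (n + 1)) (B := B) (C' := C') hBC
      have hcont : ∀ p : ℝ[X], ContinuousOn (fun x => p.eval x * x ^ (((n + 1) % 3 + 2) / 3))
          (Icc 0 (α ^ 3)) := fun p => p.continuousOn.mul (by fun_prop)
      have hlin : ∀ (u v : ℝ[X]) (B C' : ℝ) (g : ℝ → ℝ), ContinuousOn g (Icc 0 (α ^ 3)) →
          ∀ y < 0, cauchyTransform μ (fun x => (C B * u + C C' * v).eval x * g x) y =
            B * cauchyTransform μ (fun x => u.eval x * g x) y +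
            C' * cauchyTransform μ (fun x => v.eval x * g x) y := by
        intro u v B C' g hg y hy
        have hi : ∀ p : ℝ[X], Integrable (fun x => p.eval x * g x / (x - y)) μ := fun p =>
          integrable_of_continuousOn_Icc hμ (continuousOn_div_sub (p.continuousOn.mul hg) hy)
        rw [cauchyTransform, cauchyTransform, cauchyTransform, ← integral_const_mul,
          ← integral_const_mul, ← integral_add ((hi u).const_mul _) ((hi v).const_mul _)]
        congr 1
        ext x
        simp only [eval_add, eval_mul, eval_C]
        ring
      constructor
      · refine interlacing_of_simple_zeros ordConnected_Ioo (by simp) hcubeQ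
          (fun y _ => (shiftedComponent n (q n)).hasDerivAt y)
          (fun y _ => (q (n + 1)).hasDerivAt y) (fun y _ B C' hBC h0 => ?_)
          (fun z y hy hz => ?_) (fun z y hy hz => hQ0 _ z y (ne_of_gt hy) hz)
        · have := (hsimple B C' hBC).1 y (by simpa using h0)
          simpa using this
        · rw [eval_shiftedComponent_eq_zero_iff _ _ (ne_of_gt hy)]
          exact hQ0 _ z y (ne_of_gt hy) hz
      · refine interlacing_of_simple_zeros ordConnected_Ioo (by simp) hcubeΨ
          (fun y hy => hasDerivAt_cauchyTransform hμ (hcont (shiftedComponent n (q n))) hy)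
          (fun y hy => hasDerivAt_cauchyTransform hμ (hcont (q (n + 1))) hy)
          (fun y hy B C' hBC h0 => ?_)
          (fun z y hy hz => ?_) (fun z y hy hz => hΨ0 _ z y hy hz)
        · have := (hsimple B C' hBC).2 y hy (by rw [hlin _ _ _ _ _ (by fun_prop) y hy]; exact h0)
          simp only [mul_div_assoc] at this ⊢
          rwa [hlin _ _ _ _ (fun x => x ^ (((n + 1) % 3 + 2) / 3) / (x - y))
            (continuousOn_div_sub (by fun_prop) hy) y hy] at this
        · rw [cauchyTransform_shiftedComponent_eq_zero_iff hμ (by omega) (horth n) hy]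
          exact hΨ0 _ z y hy hz
  refine ⟨⟨?_, hgoal.1.2⟩, ?_, hgoal.2.2⟩
  · rintro ⟨z, ⟨⟨k, -, t, ht, rfl⟩, hz0⟩, hz⟩
    have ht0 : 0 < t := lt_of_le_of_ne ht.1 fun h => hz0 (by simp [← h])
    exact hgoal.1.1 _ (t ^ 3) (pow_pos ht0 3)
      (by rw [mul_pow, cubeRoot_pow_three, one_mul, Complex.ofReal_pow]) hz
  · rintro ⟨z, ⟨k, -, t, ht, rfl⟩, hz⟩
    exact hgoal.2.1 _ (t ^ 3) (show t ^ 3 < 0 from Odd.pow_neg (by decide) (by linarith [ht.2]))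
      (by rw [mul_pow, cubeRoot_pow_three, one_mul, Complex.ofReal_pow]) hz
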